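/- Let $\mathbb{D}=\{z\in\mathbb{C}:|z|<1\}$ and $\mathbb{D}_r=\{z\in\mathbb{C}:|z|<r\}$, and let $n\ge 1$ be an integer. The equation $$(n-1)r^{n+1}+(n+1)r^n+r-1=0$$ has exactly one root $r_{n,2}$ in the interval $(0,1)$, and the following hold. 1. Let $\theta\in\mathbb{R}$ and let $f=h+\overline{g}$, where $h$ and $g$ are analytic in $\mathbb{D}$, $h(0)=h'(0)-1=0$, $g(0)=0$, $h$ is injective in $\mathbb{D}$, and $g(z)=e^{i\theta}z^n h(z)$ for all $z\in\mathbb{D}$. Then $f$ is injective in $\mathbb{D}_{r_{n,2}}$. 2. The constant $r_{n,2}$ cannot be improved: for every $\theta\in\mathbb{R}$ there is a mapping $f=h+\overline{g}$ as in 1 (with this $n$ and $\theta$) that is not injective in $\mathbb{D}_r$ for any $r$ with $r_{n,2}<r\le 1$. 3. To the accuracy of the digits shown, that is, up to an error less than half a unit of the last digit, $r_{1,2}\approx 0.333$, $r_{2,2}\approx 0.414$, $r_{3,2}\approx 0.4738$, $r_{4,2}\approx 0.5201$, $r_{5,2}\approx 0.5574$. -/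

import Mathlib

/-- The open disk `{z : |z| < r}` in the complex plane; `disk 1` is the open unit disk. -/
def disk (r : ℝ) : Set ℂ := Metric.ball (0 : ℂ) r

/-- `f` is a normalized harmonic mapping of the unit disk with analytic part `h` and co-analytic
part `g`: `h` and `g` are holomorphic in the unit disk, `f = h + conj g` there, and
`h(0) = 0`, `h'(0) = 1`, `g(0) = 0`. -/
structure IsHar (f h g : ℂ → ℂ) : Prop where
  analytic_part : DifferentiableOn ℂ h (disk 1)
  coanalytic_part : DifferentiableOn ℂ g (disk 1)
  eq_add_conj : ∀ z ∈ disk 1, f z = h z + (starRingEnd ℂ) (g z)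
  h_zero : h 0 = 0
  deriv_h_zero : deriv h 0 = 1
  g_zero : g 0 = 0

/-- `f = h + conj g` is a normalized harmonic mapping of the unit disk whose analytic part `h` is
injective and `g(z) = e^{iθ} z^n h(z)` in the unit disk. -/
structure IsPowerHar (n : ℕ) (θ : ℝ) (f h g : ℂ → ℂ) : Prop where
  isHar : IsHar f h g
  h_injOn : Set.InjOn h (disk 1)
  g_eq : ∀ z ∈ disk 1, g z = Complex.exp (θ * Complex.I) * z ^ n * h z

/-- `r` is a root of `(n - 1) r^(n+1) + (n + 1) r^n + r - 1 = 0` in the interval `(0, 1)`. -/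
def IsRadiusRoot (n : ℕ) (r : ℝ) : Prop :=
  r ∈ Set.Ioo (0 : ℝ) 1 ∧
    ((n : ℝ) - 1) * r ^ (n + 1) + ((n : ℝ) + 1) * r ^ n + r - 1 = 0

/-! If `f z = f w` with `z ≠ w`, then `|h z - h w| = |z ^ n h z - w ^ n h w|`, because conjugation
and the factor `e^{iθ}` preserve moduli. So injectivity follows once the quotient of the right-hand
difference by `h z - h w` has modulus less than 1. That quotient is `z ^ n + (∑ z ^ i w ^ (n-1-i)) *
h w / dslope h w z`. It is holomorphic in each variable and symmetric, so by the maximum principle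
it suffices to bound it for `|z| = |w| = r`. There `|h w / dslope h w z| ≤ r (1+r) / (1-r)`
(`norm_le_mul_norm_dslope`), and the resulting bound `r^n + n r^n (1+r)/(1-r)` is less than 1
exactly when `radiusPoly n r < 0`.

The distortion bound comes from Goluzin's inequality (`norm_dslope_mul_le_of_injOn`), used twice:
directly at the pairs `(w, 0)`, `(0, z)`, and on an odd square-root transform, which gives the Koebe
growth estimate.

Goluzin's inequality is proved by area. The map `T = (h - h w₁)/(h - h w₂) = (z - w₁)/(z - w₂) * exp
A` is injective, so the logarithmic area of its image, the integral of `|T'/T|²`, is at most that of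
an annulus. Removing small Apollonius disks around `w₁` and `w₂` and letting them shrink leaves `∫
|A'|² ≤ π * logKernel w₁ w₂` (`setIntegral_norm_sq_le_logKernel`). Pairing `A'` with the reproducing
kernel of the Dirichlet space then bounds `A z₁ - A z₂`.

For sharpness, a rotated Koebe function makes `f` on a suitable ray a fixed unimodular number times
`t (1 - t^n)/(1+t)^2`, whose derivative is `-radiusPoly n t / (1+t)^3`. It turns back after the
root, so it repeats values there. -/

/-! ### Injective holomorphic functions: derivatives, difference quotients, logarithms. -/

open Set Filter Topology Metric in
/-- An injective holomorphic function has nonvanishing derivative. -/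
theorem deriv_ne_zero_of_injOn {h : ℂ → ℂ} {U : Set ℂ} (hU : IsOpen U)
    (hd : DifferentiableOn ℂ h U) (hi : InjOn h U) {a : ℂ} (ha : a ∈ U) : deriv h a ≠ 0 := by
  have hopen : ∀ z ∈ U, 𝓝 (h z) ≤ map h (𝓝 z) := by
    intro z hz
    refine ((hd.analyticAt (hU.mem_nhds hz)).eventually_constant_or_nhds_le_map_nhds).resolve_left
      fun hc => ?_
    have h1 : ∀ᶠ x in 𝓝[≠] z, h x = h z ∧ x ∈ U ∧ x ≠ z :=
      (hc.filter_mono nhdsWithin_le_nhds).and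
        (((hU.eventually_mem hz).filter_mono nhdsWithin_le_nhds).and
          self_mem_nhdsWithin)
    obtain ⟨x, hx1, hx2, hx3⟩ := h1.exists
    exact hx3 (hi hx2 hz hx1)
  set g := Function.invFunOn h U with hg
  have hgh : ∀ z ∈ U, g (h z) = z := fun z hz => hi.leftInvOn_invFunOn hz
  have hcont : ∀ z ∈ U, ContinuousAt g (h z) := by
    intro z hz
    have : Tendsto g (map h (𝓝 z)) (𝓝 z) := by
      rw [tendsto_map'_iff]
      refine tendsto_id.congr' ?_
      filter_upwards [hU.mem_nhds hz] with x hx using (hgh x hx).symm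
    unfold ContinuousAt
    rw [hgh z hz]
    exact this.mono_left (hopen z hz)
  have hright : ∀ z ∈ U, ∀ᶠ b in 𝓝 (h z), h (g b) = b := by
    intro z hz
    have : ∀ᶠ b in map h (𝓝 z), h (g b) = b := by
      rw [eventually_map]
      filter_upwards [hU.mem_nhds hz] with x hx
      rw [hgh x hx]
    exact this.filter_mono (hopen z hz)
  have hda : AnalyticAt ℂ (deriv h) a := (hd.analyticAt (hU.mem_nhds ha)).deriv
  -- Zeros of `deriv h` are isolated, since otherwise `h` would be constant near `a`.
  have hne : ∀ᶠ z in 𝓝[≠] a, deriv h z ≠ 0 := by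
    refine hda.eventually_eq_zero_or_eventually_ne_zero.resolve_left fun h0 => ?_
    obtain ⟨r, hr, hball⟩ := Metric.eventually_nhds_iff_ball.1
      (h0.and (hU.eventually_mem ha))
    have hconst : ∀ x ∈ ball a r, ∀ y ∈ ball a r, h x = h y := fun x hx y hy =>
      isOpen_ball.is_const_of_deriv_eq_zero (convex_ball a r).isPreconnected
        (hd.mono fun z hz => (hball z hz).2) (fun z hz => (hball z hz).1) hx hy
    have hx : a + (r / 2 : ℝ) ∈ ball a r := by
      simp [abs_of_pos hr, hr]
    have := hi (hball _ hx).2 ha (hconst _ hx a (mem_ball_self hr))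
    simp [hr.ne'] at this
  -- The inverse is continuous at `h a` and holomorphic nearby off that point, so the singularity is
  -- removable; the chain rule for `g ∘ h = id` then excludes `deriv h a = 0`.
  have hgan : AnalyticAt ℂ g (h a) := by
    refine Complex.analyticAt_of_differentiable_on_punctured_nhds_of_continuousAt ?_ (hcont a ha)
    have h2 : ∀ᶠ z in 𝓝 a, z ≠ a → deriv h z ≠ 0 := eventually_nhdsWithin_iff.1 hne
    have h3 : ∀ᶠ b in 𝓝 (h a), b ≠ h a → DifferentiableAt ℂ g b := by
      refine Filter.Eventually.filter_mono (hopen a ha) ?_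
      rw [eventually_map]
      filter_upwards [h2, hU.mem_nhds ha] with z hz hzU hza
      have hza' : z ≠ a := fun e => hza (by rw [e])
      have hdz : HasDerivAt h (deriv h z) (g (h z)) := by
        rw [hgh z hzU]
        exact (hd.differentiableAt (hU.mem_nhds hzU)).hasDerivAt
      exact (HasDerivAt.of_local_left_inverse (hcont z hzU) hdz (hz hza')
        (hright z hzU)).differentiableAt
    exact eventually_nhdsWithin_iff.2 h3
  have hcomp : HasDerivAt (g ∘ h) (deriv g (h a) * deriv h a) a :=
    hgan.differentiableAt.hasDerivAt.comp a (hd.differentiableAt (hU.mem_nhds ha)).hasDerivAt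
  have hid : HasDerivAt (g ∘ h) 1 a := by
    refine (hasDerivAt_id a).congr_of_eventuallyEq ?_
    filter_upwards [hU.mem_nhds ha] with x hx using hgh x hx
  intro h0
  have := hcomp.unique hid
  simp [h0] at this

/-- The difference quotient of an injective holomorphic function does not vanish. -/
theorem dslope_ne_zero_of_injOn {h : ℂ → ℂ} {U : Set ℂ} (hU : IsOpen U)
    (hd : DifferentiableOn ℂ h U) (hi : Set.InjOn h U) {a z : ℂ} (ha : a ∈ U) (hz : z ∈ U) :
    dslope h a z ≠ 0 := by
  rcases eq_or_ne z a with rfl | hza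
  · rw [dslope_same]
    exact deriv_ne_zero_of_injOn hU hd hi hz
  · rw [dslope_of_ne _ hza, slope_def_field]
    exact div_ne_zero (sub_ne_zero.2 fun e => hza (hi hz ha e)) (sub_ne_zero.2 hza)

theorem dslope_comm_field (h : ℂ → ℂ) (a b : ℂ) : dslope h a b = dslope h b a := by
  rcases eq_or_ne a b with rfl | hab
  · rfl
  · rw [dslope_of_ne _ hab.symm, dslope_of_ne _ hab, slope_comm]

open Metric in
/-- A nonvanishing holomorphic function on a disk has a holomorphic logarithm. -/
theorem exists_log_on_ball {E : ℂ → ℂ} {R : ℝ} (hd : DifferentiableOn ℂ E (ball 0 R))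
    (h0 : ∀ z ∈ ball (0 : ℂ) R, E z ≠ 0) :
    ∃ A : ℂ → ℂ, DifferentiableOn ℂ A (ball 0 R) ∧ ∀ z ∈ ball (0 : ℂ) R, Complex.exp (A z) = E z := by
  rcases le_or_gt R 0 with hR | hR
  · refine ⟨0, ?_, ?_⟩ <;> simp [ball_eq_empty.2 hR]
  have hq : DifferentiableOn ℂ (fun z => deriv E z / E z) (ball 0 R) :=
    (hd.deriv isOpen_ball).div hd h0
  obtain ⟨A, hA0, hA⟩ := (hq.isExactOn_ball).with_val_at 0 (Complex.log (E 0))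
  refine ⟨A, fun z hz => (hA z hz).differentiableAt.differentiableWithinAt, fun z hz => ?_⟩
  have hder : ∀ x ∈ ball (0 : ℂ) R, HasDerivAt (fun z => Complex.exp (-A z) * E z) 0 x := by
    intro x hx
    have h1 := ((hA x hx).neg.cexp).mul (hd.differentiableAt (isOpen_ball.mem_nhds hx)).hasDerivAt
    have := h0 x hx
    refine h1.congr_deriv ?_
    field_simp
    ring
  have hconst := isOpen_ball.is_const_of_deriv_eq_zero (convex_ball (0 : ℂ) R).isPreconnected
    (fun x hx => (hder x hx).differentiableAt.differentiableWithinAt)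
    (fun x hx => (hder x hx).deriv) hz (mem_ball_self hR)
  simp only [hA0] at hconst
  rw [Complex.exp_neg, Complex.exp_neg, Complex.exp_log (h0 0 (mem_ball_self hR)),
    inv_mul_cancel₀ (h0 0 (mem_ball_self hR)), inv_mul_eq_one₀ (Complex.exp_ne_zero _)] at hconst
  exact hconst

/-! ### Holomorphic change of variables and polar coordinates on the disk. -/

/-- The determinant of multiplication by a complex number, as a real linear map. -/
theorem det_toSpanSingleton_restrictScalars (c : ℂ) :
    ((ContinuousLinearMap.toSpanSingleton ℂ c).restrictScalars ℝ).det = ‖c‖ ^ 2 := by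
  simp [ContinuousLinearMap.det, LinearMap.det_restrictScalars, Algebra.norm_complex_eq,
    Complex.normSq_eq_norm_sq]

open MeasureTheory in
/-- Holomorphic change of variables for nonnegative functions. -/
theorem lintegral_image_eq_lintegral_norm_deriv_sq_mul {s : Set ℂ} (hs : MeasurableSet s)
    {f f' : ℂ → ℂ} (hf' : ∀ z ∈ s, HasDerivAt f (f' z) z) (hf : Set.InjOn f s)
    (g : ℂ → ENNReal) :
    ∫⁻ x in f '' s, g x = ∫⁻ z in s, ENNReal.ofReal (‖f' z‖ ^ 2) * g (f z) := by
  rw [lintegral_image_eq_lintegral_abs_det_fderiv_mul volume hs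
    (fun z hz => ((hf' z hz).hasFDerivAt.restrictScalars ℝ).hasFDerivWithinAt) hf]
  refine lintegral_congr fun z => ?_
  rw [det_toSpanSingleton_restrictScalars, abs_of_nonneg (by positivity)]

open MeasureTheory Metric Set Real in
/-- Integration over the unit disk in polar coordinates. -/
theorem setIntegral_ball_eq_integral_circleAverage {F : ℂ → ℂ} (hm : Measurable F)
    (hF : IntegrableOn F (ball 0 1)) :
    ∫ z in ball (0 : ℂ) 1, F z = 2 * π * ∫ r in (0 : ℝ)..1, r * circleAverage F 0 r := by
  set G : ℝ × ℝ → ℂ := fun p => p.1 • F (circleMap 0 p.1 p.2) with hG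
  have hsymm : ∀ p : ℝ × ℝ, Complex.polarCoord.symm p = circleMap 0 p.1 p.2 := by
    intro p
    simp [circleMap, Complex.exp_mul_I]
  have hmem : ∀ p ∈ polarCoord.target, (circleMap 0 p.1 p.2 ∈ ball (0 : ℂ) 1 ↔ p.1 < 1) := by
    rintro ⟨r, t⟩ ⟨hr, -⟩
    simp only [mem_Ioi] at hr
    simp [circleMap, abs_of_pos hr]
  have hGm : Measurable G := by
    refine measurable_fst.smul (hm.comp ?_)
    exact (by fun_prop : Continuous fun p : ℝ × ℝ => circleMap 0 p.1 p.2).measurable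
  have hset : MeasurableSet (Iio (1 : ℝ) ×ˢ (univ : Set ℝ)) := measurableSet_Iio.prod .univ
  have hinter : polarCoord.target ∩ Iio (1 : ℝ) ×ˢ (univ : Set ℝ) = Ioo (0 : ℝ) 1 ×ˢ Ioo (-π) π := by
    ext ⟨r, t⟩
    simp [polarCoord]
    tauto
  have hind : ∀ p ∈ polarCoord.target,
      (p.1 • (ball (0 : ℂ) 1).indicator F (Complex.polarCoord.symm p)) =
      (Iio (1 : ℝ) ×ˢ (univ : Set ℝ)).indicator G p := by
    intro p hp
    rw [hsymm]
    by_cases h : p.1 < 1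
    · rw [indicator_of_mem ((hmem p hp).2 h), indicator_of_mem (by simpa using h)]
    · rw [indicator_of_notMem (fun h' => h ((hmem p hp).1 h')),
        indicator_of_notMem (by simpa using h), smul_zero]
  have hint : IntegrableOn G (Ioo (0 : ℝ) 1 ×ˢ Ioo (-π) π) := by
    refine ⟨hGm.aestronglyMeasurable, ?_⟩
    have hlt : ∫⁻ z in ball (0 : ℂ) 1, ‖F z‖ₑ < ⊤ := hF.2
    rw [← lintegral_indicator measurableSet_ball, ← Complex.lintegral_comp_polarCoord_symm] at hlt
    have hsub : Ioo (0 : ℝ) 1 ×ˢ Ioo (-π) π ⊆ polarCoord.target :=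
      hinter ▸ inter_subset_left
    refine lt_of_le_of_lt (le_trans ?_ (lintegral_mono_set hsub)) hlt
    refine le_of_eq (setLIntegral_congr_fun (measurableSet_Ioo.prod measurableSet_Ioo) ?_)
    intro p hp
    have hp' : p ∈ polarCoord.target := hsub hp
    have h1 : p.1 < 1 := hp.1.2
    have h0 : 0 < p.1 := hp.1.1
    simp only [hsymm]
    rw [indicator_of_mem ((hmem p hp').2 h1)]
    simp only [hG, enorm_smul, Real.enorm_of_nonneg h0.le, smul_eq_mul]
  calc ∫ z in ball (0 : ℂ) 1, F z = ∫ z, (ball (0 : ℂ) 1).indicator F z :=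
        (integral_indicator measurableSet_ball).symm
    _ = ∫ p in polarCoord.target, p.1 • (ball (0 : ℂ) 1).indicator F (Complex.polarCoord.symm p) :=
        (Complex.integral_comp_polarCoord_symm _).symm
    _ = ∫ p in polarCoord.target, (Iio (1 : ℝ) ×ˢ (univ : Set ℝ)).indicator G p :=
        setIntegral_congr_fun polarCoord.open_target.measurableSet hind
    _ = ∫ p in Ioo (0 : ℝ) 1 ×ˢ Ioo (-π) π, G p := by
        rw [setIntegral_indicator hset, hinter]
    _ = ∫ r in Ioo (0 : ℝ) 1, ∫ t in Ioo (-π) π, G (r, t) := setIntegral_prod _ hint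
    _ = ∫ r in Ioo (0 : ℝ) 1, 2 * π * (r * circleAverage F 0 r) := by
        refine setIntegral_congr_fun measurableSet_Ioo fun r _ => ?_
        simp only [hG]
        rw [integral_smul, ← integral_Ioc_eq_integral_Ioo,
          ← intervalIntegral.integral_of_le (by linarith [pi_pos]), circleAverage_def]
        have hper : (fun t => F (circleMap 0 r t)).Periodic (2 * π) :=
          fun x => by simp [periodic_circleMap 0 r x]
        have := hper.intervalIntegral_add_eq (-π) 0
        rw [show -π + 2 * π = π by ring, zero_add] at this
        rw [this]
        simp only [Complex.real_smul, Complex.ofReal_inv, Complex.ofReal_mul, Complex.ofReal_ofNat]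
        have : (π : ℂ) ≠ 0 := by exact_mod_cast pi_ne_zero
        field_simp
    _ = 2 * π * ∫ r in (0 : ℝ)..1, r * circleAverage F 0 r := by
        rw [integral_const_mul, intervalIntegral.integral_of_le zero_le_one,
          integral_Ioc_eq_integral_Ioo]

/-! ### Integrals of holomorphic functions against conjugated Cauchy kernels. -/

open Metric Real in
/-- On the circle of radius `ρ`, the conjugate of `1 / (z - w)` is a rational function. -/
theorem conj_inv_sub_of_mem_sphere {ρ : ℝ} (hρ : 0 < ρ) {z : ℂ} (hz : z ∈ sphere (0 : ℂ) ρ) (w : ℂ) :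
    (starRingEnd ℂ) ((z - w)⁻¹) = z / (ρ ^ 2 - (starRingEnd ℂ) w * z) := by
  have hzn : ‖z‖ = ρ := by simpa using hz
  have hz0 : z ≠ 0 := by
    rintro rfl
    simp at hzn
    exact hρ.ne hzn
  have hc : z * (starRingEnd ℂ) z = ρ ^ 2 := by
    rw [Complex.mul_conj, Complex.normSq_eq_norm_sq, hzn]
    norm_cast
  rw [← hc, show z * (starRingEnd ℂ) z - (starRingEnd ℂ) w * z
    = z * ((starRingEnd ℂ) z - (starRingEnd ℂ) w) by ring, map_inv₀, map_sub]
  rw [div_mul_eq_div_div, div_self hz0, one_div]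

-- On the circle the integrand agrees with `a z * z / (ρ² - conj w * z)`. Its pole `ρ² / conj w`
-- lies outside, so the average is the value at 0, where the factor `z` vanishes.
open Metric Real in
theorem circleAverage_mul_conj_inv_sub_of_norm_lt {a : ℂ → ℂ} {R ρ : ℝ} (hρ : 0 < ρ) (hR : ρ < R)
    (ha : DifferentiableOn ℂ a (ball 0 R)) {w : ℂ} (hw : ‖w‖ < ρ) :
    circleAverage (fun z => a z * (starRingEnd ℂ) ((z - w)⁻¹)) 0 ρ = 0 := by
  have hne : ∀ z ∈ closedBall (0 : ℂ) ρ, (ρ : ℂ) ^ 2 - (starRingEnd ℂ) w * z ≠ 0 := by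
    intro z hz h0
    have hz' : ‖z‖ ≤ ρ := by simpa using hz
    have : ‖(ρ : ℂ) ^ 2‖ = ‖w‖ * ‖z‖ := by
      rw [sub_eq_zero.1 h0, norm_mul, Complex.norm_conj]
    rw [norm_pow, Complex.norm_real, norm_eq_abs, sq_abs] at this
    nlinarith [norm_nonneg w, norm_nonneg z]
  have hd : DifferentiableOn ℂ (fun z => a z * (z / (ρ ^ 2 - (starRingEnd ℂ) w * z)))
      (closedBall 0 ρ) := by
    refine (ha.mono (closedBall_subset_ball hR)).mul (DifferentiableOn.div (by fun_prop) (by fun_prop) hne)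
  have hdc : DiffContOnCl ℂ (fun z => a z * (z / (ρ ^ 2 - (starRingEnd ℂ) w * z))) (ball 0 |ρ|) := by
    rw [abs_of_pos hρ]
    refine DifferentiableOn.diffContOnCl ?_
    rwa [closure_ball _ hρ.ne']
  rw [circleAverage_congr_sphere (f₂ := fun z => a z * (z / (ρ ^ 2 - (starRingEnd ℂ) w * z)))
    (fun z hz => ?_), hdc.circleAverage]
  · simp
  · rw [abs_of_pos hρ] at hz
    simp only [conj_inv_sub_of_mem_sphere hρ hz]

-- Here the reflected point `ρ² / conj w` lies inside the circle, and Cauchy's formula evaluates `a`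
-- there.
open Metric Real in
theorem circleAverage_mul_conj_inv_sub_of_lt_norm {a : ℂ → ℂ} {R ρ : ℝ} (hρ : 0 < ρ) (hR : ρ < R)
    (ha : DifferentiableOn ℂ a (ball 0 R)) {w : ℂ} (hw : ρ < ‖w‖) :
    circleAverage (fun z => a z * (starRingEnd ℂ) ((z - w)⁻¹)) 0 ρ =
      -(1 / (starRingEnd ℂ) w * a (ρ ^ 2 / (starRingEnd ℂ) w)) := by
  have hw0 : (starRingEnd ℂ) w ≠ 0 := by
    intro h
    rw [map_eq_zero] at h
    simp [h] at hw
    linarith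
  have hd : DiffContOnCl ℂ a (ball 0 |ρ|) := by
    rw [abs_of_pos hρ]
    refine DifferentiableOn.diffContOnCl ?_
    rw [closure_ball _ hρ.ne']
    exact ha.mono (closedBall_subset_ball hR)
  have hmem : (ρ : ℂ) ^ 2 / (starRingEnd ℂ) w ∈ ball (0 : ℂ) |ρ| := by
    rw [mem_ball_zero_iff, norm_div, norm_pow, Complex.norm_conj, Complex.norm_real, norm_eq_abs,
      sq_abs, abs_of_pos hρ, div_lt_iff₀ (hρ.trans hw)]
    nlinarith
  rw [← hd.circleAverage_smul_div hmem]
  rw [circleAverage_congr_sphere (f₂ := fun z => (-(1 / (starRingEnd ℂ) w)) •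
    (((z - 0) / (z - ρ ^ 2 / (starRingEnd ℂ) w)) • a z)) (fun z hz => ?_), circleAverage_fun_smul]
  · simp [smul_eq_mul]
  · rw [abs_of_pos hρ] at hz
    have hzn : ‖z‖ = ρ := by simpa using hz
    have h1 : (ρ : ℂ) ^ 2 - (starRingEnd ℂ) w * z ≠ 0 := by
      intro h0
      have : ‖(ρ : ℂ) ^ 2‖ = ‖w‖ * ‖z‖ := by
        rw [sub_eq_zero.1 h0, norm_mul, Complex.norm_conj]
      rw [norm_pow, Complex.norm_real, norm_eq_abs, sq_abs, hzn] at this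
      nlinarith
    have h2 : z * (starRingEnd ℂ) w - ρ ^ 2 ≠ 0 := by
      intro h
      apply h1
      linear_combination -h
    simp only [conj_inv_sub_of_mem_sphere hρ hz, smul_eq_mul]
    rw [show z - (ρ : ℂ) ^ 2 / (starRingEnd ℂ) w = (z * (starRingEnd ℂ) w - ρ ^ 2) / (starRingEnd ℂ) w
      by field_simp]
    rw [show (ρ : ℂ) ^ 2 - (starRingEnd ℂ) w * z = -(z * (starRingEnd ℂ) w - ρ ^ 2) by ring]
    field_simp
    ring

open MeasureTheory Metric Set Real in
theorem lintegral_ball_inv_norm_lt_top (r : ℝ) :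
    ∫⁻ z in ball (0 : ℂ) r, ‖z⁻¹‖ₑ < ⊤ := by
  rw [← lintegral_indicator measurableSet_ball, ← Complex.lintegral_comp_polarCoord_symm]
  calc ∫⁻ p in polarCoord.target, ENNReal.ofReal p.1 •
        (ball (0 : ℂ) r).indicator (fun z => ‖z⁻¹‖ₑ) (Complex.polarCoord.symm p)
      ≤ ∫⁻ p in polarCoord.target, (Iio r ×ˢ (univ : Set ℝ)).indicator 1 p := by
        refine setLIntegral_mono_ae' polarCoord.open_target.measurableSet (ae_of_all _ fun p hp => ?_)
        have hp0 : 0 < p.1 := hp.1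
        by_cases h : Complex.polarCoord.symm p ∈ ball (0 : ℂ) r
        · have h' : p.1 < r := by
            rwa [mem_ball_zero_iff, Complex.norm_polarCoord_symm, abs_of_pos hp0] at h
          have hne : Complex.polarCoord.symm p ≠ 0 := by
            rw [← norm_pos_iff, Complex.norm_polarCoord_symm]
            exact abs_pos.2 hp0.ne'
          rw [indicator_of_mem h, indicator_of_mem (by simpa using h'), enorm_inv hne, ← ofReal_norm,
            Complex.norm_polarCoord_symm, abs_of_pos hp0, smul_eq_mul, Pi.one_apply]
          exact (ENNReal.mul_inv_cancel (by simpa using hp0) ENNReal.ofReal_ne_top).le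
        · rw [indicator_of_notMem h]
          simp
    _ ≤ volume (Ioo (0 : ℝ) r ×ˢ Ioo (-π) π) := by
        rw [setLIntegral_indicator (measurableSet_Iio.prod .univ)]
        simp only [Pi.one_apply, lintegral_one, Measure.restrict_apply_univ]
        refine measure_mono ?_
        rintro ⟨x, t⟩ ⟨h1, h2⟩
        exact ⟨⟨h2.1, h1.1⟩, h2.2⟩
    _ < ⊤ := by
        rw [Measure.volume_eq_prod, Measure.prod_prod]
        simp [ENNReal.mul_lt_top]

open MeasureTheory Metric Set in
theorem integrableOn_ball_inv_sub (w : ℂ) (r : ℝ) :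
    IntegrableOn (fun z : ℂ => (z - w)⁻¹) (ball 0 r) := by
  refine ⟨(by fun_prop : Measurable fun z : ℂ => (z - w)⁻¹).aestronglyMeasurable, ?_⟩
  have h1 : ∫⁻ z in ball (0 : ℂ) r, ‖(z - w)⁻¹‖ₑ ≤ ∫⁻ z in ball (0 : ℂ) (r + ‖w‖), ‖z⁻¹‖ₑ := by
    rw [← lintegral_indicator measurableSet_ball, ← lintegral_indicator measurableSet_ball,
      ← lintegral_sub_right_eq_self ((ball (0 : ℂ) (r + ‖w‖)).indicator _) w]
    refine lintegral_mono fun z => ?_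
    by_cases h : z ∈ ball (0 : ℂ) r
    · have h' : z - w ∈ ball (0 : ℂ) (r + ‖w‖) := by
        rw [mem_ball_zero_iff] at h ⊢
        exact (norm_sub_le _ _).trans_lt (by linarith)
      rw [indicator_of_mem h, indicator_of_mem h']
    · rw [indicator_of_notMem h]
      exact zero_le
  exact h1.trans_lt (lintegral_ball_inv_norm_lt_top _)

open MeasureTheory Metric Set in
/-- The product of a bounded holomorphic function and the conjugate of `1 / (z - w)`. -/
theorem integrableOn_mul_conj_inv_sub {a : ℂ → ℂ} {R : ℝ} (hR : 1 < R)
    (ha : DifferentiableOn ℂ a (ball 0 R)) (w : ℂ) :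
    IntegrableOn (fun z => a z * (starRingEnd ℂ) ((z - w)⁻¹)) (ball 0 1) := by
  have hcont : ContinuousOn a (closedBall 0 1) :=
    ha.continuousOn.mono (closedBall_subset_ball hR)
  obtain ⟨C, hC⟩ := (isCompact_closedBall (0 : ℂ) 1).exists_bound_of_continuousOn hcont
  have hc : IntegrableOn (fun z : ℂ => (starRingEnd ℂ) ((z - w)⁻¹)) (ball 0 1) := by
    have := (integrableOn_ball_inv_sub w 1)
    exact (Complex.conjCLE.toContinuousLinearMap.integrable_comp this)
  refine Integrable.bdd_mul (c := C) hc
    ((hcont.mono ball_subset_closedBall).aestronglyMeasurable measurableSet_ball) ?_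
  refine (ae_restrict_iff' measurableSet_ball).2 (ae_of_all _ fun z hz => hC z (ball_subset_closedBall hz))

open MeasureTheory Metric Set Real in
theorem setIntegral_mul_conj_inv_sub_polar {a : ℂ → ℂ} {R : ℝ} (hR : 1 < R)
    (ha : DifferentiableOn ℂ a (ball 0 R)) (w : ℂ) :
    ∫ z in ball (0 : ℂ) 1, a z * (starRingEnd ℂ) ((z - w)⁻¹) =
      2 * π * ∫ r in (0 : ℝ)..1, r * circleAverage (fun z => a z * (starRingEnd ℂ) ((z - w)⁻¹)) 0 r := by
  -- Nothing is known about `a` off the disk; the indicator supplies the global measurability that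
  -- the polar formula needs.
  set F : ℂ → ℂ := fun z => (ball (0 : ℂ) R).indicator a z * (starRingEnd ℂ) ((z - w)⁻¹) with hF
  have heq : EqOn F (fun z => a z * (starRingEnd ℂ) ((z - w)⁻¹)) (ball 0 R) := fun z hz => by
    simp only [hF, indicator_of_mem hz]
  have hm : Measurable F := by
    have h1 : Measurable ((ball (0 : ℂ) R).indicator a) := by
      classical
      rw [← piecewise_eq_indicator]
      exact ha.continuousOn.measurable_piecewise continuousOn_const measurableSet_ball
    have h2 : Measurable (starRingEnd ℂ) := Complex.continuous_conj.measurable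
    exact h1.mul (h2.comp (by fun_prop))
  have hint : IntegrableOn F (ball 0 1) :=
    (integrableOn_mul_conj_inv_sub hR ha w).congr_fun
      (fun z hz => (heq (ball_subset_ball hR.le hz)).symm) measurableSet_ball
  have := setIntegral_ball_eq_integral_circleAverage hm hint
  rw [setIntegral_congr_fun measurableSet_ball fun z hz => heq (ball_subset_ball hR.le hz)] at this
  rw [this]
  congr 1
  refine intervalIntegral.integral_congr fun r hr => ?_
  rw [uIcc_of_le zero_le_one] at hr
  refine congrArg _ ?_
  refine circleAverage_congr_sphere fun z hz => heq ?_
  rw [abs_of_nonneg hr.1] at hz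
  exact closedBall_subset_ball (hr.2.trans_lt hR) (sphere_subset_closedBall hz)

-- The integrand is the derivative of `-A (r² v) / 2`. It is used with `c = ‖w‖`, `v = 1 / conj w`
-- for a pole inside the disk, and with `c = 1` for the reproducing kernel.
open MeasureTheory Metric Set Real in
theorem integral_radial_primitive {a A : ℂ → ℂ} {R c : ℝ} (hR : 1 < R)
    (hA : ∀ z ∈ ball (0 : ℂ) R, HasDerivAt A (a z) z) (ha : DifferentiableOn ℂ a (ball 0 R))
    {v : ℂ} (hc : 0 ≤ c) (hcv : c ^ 2 * ‖v‖ ≤ 1) :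
    ∫ r in (0 : ℝ)..c, r * -(v * a (r ^ 2 * v)) = -(A (c ^ 2 * v) - A 0) / 2 := by
  have hmem : ∀ r ∈ uIcc 0 c, (r : ℂ) ^ 2 * v ∈ ball (0 : ℂ) R := by
    intro r hr
    rw [uIcc_of_le hc] at hr
    rw [mem_ball_zero_iff, norm_mul, norm_pow, Complex.norm_real, norm_eq_abs, sq_abs]
    refine lt_of_le_of_lt (le_trans ?_ hcv) hR
    have := hr.1
    have := hr.2
    gcongr
  have hder : ∀ r ∈ uIcc 0 c, HasDerivAt (fun r : ℝ => -(A (r ^ 2 * v)) / 2)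
      (r * -(v * a (r ^ 2 * v))) r := by
    intro r hr
    have h1 : HasDerivAt (fun r : ℝ => (r : ℂ) ^ 2 * v) (2 * r * v) r := by
      have := ((Complex.ofRealCLM.hasDerivAt (x := r)).pow 2).mul_const v
      refine this.congr_deriv ?_
      simp
    have := ((hA _ (hmem r hr)).comp r h1).neg.div_const 2
    refine this.congr_deriv ?_
    ring
  rw [intervalIntegral.integral_eq_sub_of_hasDerivAt hder]
  · simp
    ring
  · refine ContinuousOn.intervalIntegrable ?_
    have h2 : ContinuousOn (fun r : ℝ => a ((r : ℂ) ^ 2 * v)) (uIcc 0 c) :=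
      ha.continuousOn.comp (by fun_prop) hmem
    exact Complex.continuous_ofReal.continuousOn.mul (continuousOn_const.mul h2).neg

open MeasureTheory Metric Set Real in
/-- The integral of a holomorphic function against the conjugate of a Cauchy kernel with pole
inside the unit disk. -/
theorem setIntegral_mul_conj_inv_sub_of_norm_lt_one {a A : ℂ → ℂ} {R : ℝ} (hR : 1 < R)
    (hA : ∀ z ∈ ball (0 : ℂ) R, HasDerivAt A (a z) z) (ha : DifferentiableOn ℂ a (ball 0 R))
    {w : ℂ} (hw : ‖w‖ < 1) :
    ∫ z in ball (0 : ℂ) 1, a z * (starRingEnd ℂ) ((z - w)⁻¹) = -π * (A w - A 0) := by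
  rw [setIntegral_mul_conj_inv_sub_polar hR ha w]
  set v := 1 / (starRingEnd ℂ) w with hv
  -- Circles that enclose `w` contribute nothing, so only radii below `‖w‖` remain.
  have hval : ∫ r in (0 : ℝ)..1, r * circleAverage (fun z => a z * (starRingEnd ℂ) ((z - w)⁻¹)) 0 r
      = ∫ r in (0 : ℝ)..1, indicator {x | x ≤ ‖w‖} (fun r : ℝ => (r : ℂ) * -(v * a (r ^ 2 * v))) r := by
    refine intervalIntegral.integral_congr_ae ?_
    have h0 : ∀ᵐ r : ℝ, r ≠ ‖w‖ := by simp [ae_iff, measure_singleton]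
    filter_upwards [h0] with r hr hr'
    rw [uIoc_of_le zero_le_one] at hr'
    rcases lt_or_gt_of_ne hr with h | h
    · rw [indicator_of_mem (by exact h.le), circleAverage_mul_conj_inv_sub_of_lt_norm hr'.1
        (hr'.2.trans_lt hR) ha h, hv, mul_one_div]
    · rw [indicator_of_notMem (by simpa using h), circleAverage_mul_conj_inv_sub_of_norm_lt hr'.1
        (hr'.2.trans_lt hR) ha h, mul_zero]
  rw [hval, intervalIntegral.integral_indicator ⟨norm_nonneg w, hw.le⟩]
  rcases eq_or_ne w 0 with rfl | hw0
  · simp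
  have hwn : 0 < ‖w‖ := norm_pos_iff.2 hw0
  have hw0' : (starRingEnd ℂ) w ≠ 0 := by simpa using hw0
  rw [integral_radial_primitive hR hA ha hwn.le]
  · have : (‖w‖ : ℂ) ^ 2 * v = w := by
      rw [hv, ← Complex.ofReal_pow, ← Complex.normSq_eq_norm_sq, ← Complex.mul_conj]
      field_simp
    rw [this]
    ring
  · rw [hv, norm_div, Complex.norm_conj, norm_one]
    field_simp
    exact hw.le

open MeasureTheory Metric Set Real in
/-- The reproducing property of the Dirichlet kernel of the unit disk. -/
theorem setIntegral_mul_conj_kernel {a A : ℂ → ℂ} {R : ℝ} (hR : 1 < R)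
    (hA : ∀ z ∈ ball (0 : ℂ) R, HasDerivAt A (a z) z) (ha : DifferentiableOn ℂ a (ball 0 R))
    {w : ℂ} (hw : ‖w‖ < 1) :
    ∫ z in ball (0 : ℂ) 1, a z * (starRingEnd ℂ) ((starRingEnd ℂ) w / (1 - (starRingEnd ℂ) w * z)) =
      π * (A w - A 0) := by
  rcases eq_or_ne w 0 with rfl | hw0
  · simp
  have hwn : 0 < ‖w‖ := norm_pos_iff.2 hw0
  have hw0' : (starRingEnd ℂ) w ≠ 0 := by simpa using hw0
  -- The kernel is `-1 / (z - u)` with `u` the reflection of `w` in the unit circle, so every circle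
  -- of radius at most 1 falls in the case of an outer pole.
  set u : ℂ := 1 / (starRingEnd ℂ) w with hu
  have hun : 1 < ‖u‖ := by
    rw [hu, norm_div, Complex.norm_conj, norm_one]
    exact (one_lt_div hwn).2 hw
  have huw : 1 / (starRingEnd ℂ) u = w := by simp [hu]
  have hk : ∀ z, a z * (starRingEnd ℂ) ((starRingEnd ℂ) w / (1 - (starRingEnd ℂ) w * z)) =
      -(a z * (starRingEnd ℂ) ((z - u)⁻¹)) := by
    intro z
    rw [← mul_neg, ← map_neg, hu]
    congr 2
    rw [show z - 1 / (starRingEnd ℂ) w = -((1 - (starRingEnd ℂ) w * z) / (starRingEnd ℂ) w) by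
      field_simp; ring]
    rw [inv_neg, neg_neg, inv_div]
  simp_rw [hk]
  rw [integral_neg, setIntegral_mul_conj_inv_sub_polar hR ha u]
  have hval : ∫ r in (0 : ℝ)..1, r * circleAverage (fun z => a z * (starRingEnd ℂ) ((z - u)⁻¹)) 0 r
      = ∫ r in (0 : ℝ)..1, r * -(w * a (r ^ 2 * w)) := by
    refine intervalIntegral.integral_congr_ae (ae_of_all _ fun r hr => ?_)
    rw [uIoc_of_le zero_le_one] at hr
    rw [circleAverage_mul_conj_inv_sub_of_lt_norm hr.1 (hr.2.trans_lt hR) ha (hr.2.trans_lt hun),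
      huw, div_eq_mul_one_div, huw]
  rw [hval, integral_radial_primitive hR hA ha zero_le_one (by simpa using hw.le)]
  simp
  ring

/-! ### The Dirichlet kernel of the disk for a difference of two point evaluations. -/

/-- The diagonal values of the Dirichlet kernel of the unit disk for the charge `δ_{w₁} - δ_{w₂}`. -/
noncomputable def logKernel (w₁ w₂ : ℂ) : ℝ :=
  Real.log (‖1 - (starRingEnd ℂ) w₂ * w₁‖ ^ 2 / ((1 - ‖w₁‖ ^ 2) * (1 - ‖w₂‖ ^ 2)))

/-- The derivative of the kernel function for the charge `δ_{w₁} - δ_{w₂}`. -/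
noncomputable def kernelDeriv (w₁ w₂ z : ℂ) : ℂ :=
  (starRingEnd ℂ) w₁ / (1 - (starRingEnd ℂ) w₁ * z) - (starRingEnd ℂ) w₂ / (1 - (starRingEnd ℂ) w₂ * z)

theorem logKernel_conj (w₁ w₂ : ℂ) :
    logKernel ((starRingEnd ℂ) w₁) ((starRingEnd ℂ) w₂) = logKernel w₁ w₂ := by
  unfold logKernel
  rw [← Complex.norm_conj (1 - _)]
  simp

theorem one_sub_ne_zero_of_norm_lt_one {x : ℂ} (hx : ‖x‖ < 1) : 1 - x ≠ 0 := by
  intro h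
  rw [← sub_eq_zero.1 h] at hx
  simp at hx

/-- Gives a disk larger than the unit disk on which the kernels of both points are holomorphic. -/
theorem exists_radius_mul_norm_lt_one {w₁ w₂ : ℂ} (h₁ : ‖w₁‖ < 1) (h₂ : ‖w₂‖ < 1) :
    ∃ R : ℝ, 1 < R ∧ R * ‖w₁‖ < 1 ∧ R * ‖w₂‖ < 1 := by
  refine ⟨2 / (1 + max ‖w₁‖ ‖w₂‖), ?_, ?_, ?_⟩
  all_goals
    have hm : max ‖w₁‖ ‖w₂‖ < 1 := max_lt h₁ h₂
    have hp : 0 < 1 + max ‖w₁‖ ‖w₂‖ := by positivity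
    have := le_max_left ‖w₁‖ ‖w₂‖
    have := le_max_right ‖w₁‖ ‖w₂‖
  · rw [lt_div_iff₀ hp]
    linarith
  all_goals
    rw [div_mul_eq_mul_div, div_lt_one hp]
    linarith

open Metric in
theorem one_sub_conj_mul_ne_zero {w z : ℂ} {R : ℝ} (hw : R * ‖w‖ < 1) (hz : z ∈ ball (0 : ℂ) R) :
    1 - (starRingEnd ℂ) w * z ≠ 0 := by
  refine one_sub_ne_zero_of_norm_lt_one ?_
  rw [mem_ball_zero_iff] at hz
  rw [norm_mul, Complex.norm_conj]
  nlinarith [norm_nonneg w]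

open Metric in
theorem differentiableOn_kernelDeriv {w₁ w₂ : ℂ} {R : ℝ} (h₁ : R * ‖w₁‖ < 1) (h₂ : R * ‖w₂‖ < 1) :
    DifferentiableOn ℂ (kernelDeriv w₁ w₂) (ball 0 R) := by
  unfold kernelDeriv
  refine DifferentiableOn.sub ?_ ?_
  · exact DifferentiableOn.div (by fun_prop) (by fun_prop)
      fun z hz => one_sub_conj_mul_ne_zero h₁ hz
  · exact DifferentiableOn.div (by fun_prop) (by fun_prop)
      fun z hz => one_sub_conj_mul_ne_zero h₂ hz

open MeasureTheory Metric in
/-- Pairing a holomorphic function with the kernel evaluates the primitive. -/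
theorem setIntegral_mul_conj_kernelDeriv {a A : ℂ → ℂ} {R : ℝ} (hR : 1 < R)
    (hA : ∀ z ∈ ball (0 : ℂ) R, HasDerivAt A (a z) z) (ha : DifferentiableOn ℂ a (ball 0 R))
    {w₁ w₂ : ℂ} (h₁ : ‖w₁‖ < 1) (h₂ : ‖w₂‖ < 1) :
    ∫ z in ball (0 : ℂ) 1, a z * (starRingEnd ℂ) (kernelDeriv w₁ w₂ z) =
      Real.pi * (A w₁ - A w₂) := by
  have hac : ContinuousOn a (closedBall 0 1) :=
    ha.continuousOn.mono (closedBall_subset_ball hR)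
  have hint : ∀ w : ℂ, ‖w‖ < 1 → IntegrableOn (fun z => a z *
      (starRingEnd ℂ) ((starRingEnd ℂ) w / (1 - (starRingEnd ℂ) w * z))) (ball 0 1) := by
    intro w hw
    refine (ContinuousOn.integrableOn_compact (isCompact_closedBall 0 1) ?_).mono_set
      ball_subset_closedBall
    refine hac.mul (Complex.continuous_conj.comp_continuousOn ?_)
    refine ContinuousOn.div (by fun_prop) (by fun_prop) fun z hz => ?_
    refine one_sub_ne_zero_of_norm_lt_one ?_
    rw [norm_mul, Complex.norm_conj]
    have : ‖z‖ ≤ 1 := by simpa using hz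
    nlinarith [norm_nonneg w]
  unfold kernelDeriv
  simp_rw [map_sub, mul_sub]
  rw [integral_sub (hint w₁ h₁) (hint w₂ h₂), setIntegral_mul_conj_kernel hR hA ha h₁, setIntegral_mul_conj_kernel hR hA ha h₂]
  ring

open MeasureTheory Metric in
/-- The Dirichlet norm of the kernel function. -/
theorem setIntegral_norm_sq_kernelDeriv {w₁ w₂ : ℂ} (h₁ : ‖w₁‖ < 1) (h₂ : ‖w₂‖ < 1) :
    ∫ z in ball (0 : ℂ) 1, ‖kernelDeriv w₁ w₂ z‖ ^ 2 = Real.pi * logKernel w₁ w₂ := by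
  obtain ⟨R, hR, hR₁, hR₂⟩ := exists_radius_mul_norm_lt_one h₁ h₂
  have hslit : ∀ w z : ℂ, R * ‖w‖ < 1 → z ∈ ball (0 : ℂ) R →
      1 - (starRingEnd ℂ) w * z ∈ Complex.slitPlane := by
    intro w z hw hz
    left
    have h : ‖(starRingEnd ℂ) w * z‖ < 1 := by
      rw [mem_ball_zero_iff] at hz
      rw [norm_mul, Complex.norm_conj]
      nlinarith [norm_nonneg w]
    have := (Complex.re_le_norm ((starRingEnd ℂ) w * z)).trans_lt h
    rw [Complex.sub_re, Complex.one_re]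
    linarith
  -- The kernel is paired with itself: its own primitive is evaluated at `w₁` and `w₂`.
  set A : ℂ → ℂ := fun z => Complex.log (1 - (starRingEnd ℂ) w₂ * z) -
    Complex.log (1 - (starRingEnd ℂ) w₁ * z) with hAdef
  have hA : ∀ z ∈ ball (0 : ℂ) R, HasDerivAt A (kernelDeriv w₁ w₂ z) z := by
    intro z hz
    have hlin : ∀ w : ℂ, HasDerivAt (fun z => 1 - (starRingEnd ℂ) w * z) (-(starRingEnd ℂ) w) z := by
      intro w
      have := ((hasDerivAt_id z).const_mul ((starRingEnd ℂ) w)).const_sub 1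
      simpa using this
    have := ((hlin w₂).clog (hslit w₂ z hR₂ hz)).sub ((hlin w₁).clog (hslit w₁ z hR₁ hz))
    refine this.congr_deriv ?_
    unfold kernelDeriv
    ring
  have hmain := setIntegral_mul_conj_kernelDeriv hR hA (differentiableOn_kernelDeriv hR₁ hR₂) h₁ h₂
  simp_rw [Complex.mul_conj, Complex.normSq_eq_norm_sq] at hmain
  rw [integral_complex_ofReal] at hmain
  have hre := congrArg Complex.re hmain
  rw [Complex.ofReal_re, Complex.re_ofReal_mul] at hre
  rw [hre]
  congr 1
  have hn : ∀ w : ℂ, 1 - (starRingEnd ℂ) w * w = ((1 - ‖w‖ ^ 2 : ℝ) : ℂ) := by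
    intro w
    rw [mul_comm, Complex.mul_conj, Complex.normSq_eq_norm_sq]
    push_cast
    rfl
  have hp : ∀ w : ℂ, ‖w‖ < 1 → 0 < 1 - ‖w‖ ^ 2 := by
    intro w hw
    nlinarith [norm_nonneg w]
  have hsym : ‖1 - (starRingEnd ℂ) w₁ * w₂‖ = ‖1 - (starRingEnd ℂ) w₂ * w₁‖ := by
    rw [← Complex.norm_conj]
    simp [mul_comm]
  have hne : ‖1 - (starRingEnd ℂ) w₂ * w₁‖ ≠ 0 := by
    rw [norm_ne_zero_iff]
    exact one_sub_conj_mul_ne_zero hR₂ (by rw [mem_ball_zero_iff]; linarith)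
  simp only [hAdef, Complex.sub_re, Complex.log_re, hn, Complex.norm_real, Real.norm_eq_abs]
  rw [abs_of_pos (hp _ h₁), abs_of_pos (hp _ h₂), hsym]
  unfold logKernel
  rw [Real.log_div (pow_ne_zero 2 hne) (mul_pos (hp _ h₁) (hp _ h₂)).ne', Real.log_mul (hp _ h₁).ne'
    (hp _ h₂).ne', Real.log_pow]
  push_cast
  ring

open MeasureTheory Metric Set in
/-- The Dirichlet integral of `log ((z - w₁) / (z - w₂))` over the complement of the unit disk. -/
theorem lintegral_compl_ball_inv_sub_sub {w₁ w₂ : ℂ} (h₁ : ‖w₁‖ < 1) (h₂ : ‖w₂‖ < 1) :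
    ∫⁻ z in (ball (0 : ℂ) 1)ᶜ, ENNReal.ofReal (‖(z - w₁)⁻¹ - (z - w₂)⁻¹‖ ^ 2) ≤
      ENNReal.ofReal (Real.pi * logKernel w₁ w₂) := by
  have himg : (closedBall (0 : ℂ) 1)ᶜ ⊆ (fun z : ℂ => z⁻¹) '' (ball 0 1 \ {0}) := by
    intro z hz
    have hz1 : 1 < ‖z‖ := by simpa using hz
    have hz0 : z ≠ 0 := by
      rintro rfl
      simp at hz1
      linarith
    refine ⟨z⁻¹, ⟨?_, by simpa using hz0⟩, inv_inv z⟩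
    rw [mem_ball_zero_iff, norm_inv]
    exact inv_lt_one_of_one_lt₀ hz1
  have hae : (closedBall (0 : ℂ) 1)ᶜ =ᵐ[volume] ((ball (0 : ℂ) 1)ᶜ : Set ℂ) := by
    refine (ae_eq_set_compl_compl.2 ?_)
    rw [← ball_union_sphere]
    exact union_ae_eq_left_of_ae_eq_empty (ae_eq_empty.2 (Measure.addHaar_sphere _ _ _))
  have hc₁ : ‖(starRingEnd ℂ) w₁‖ < 1 := by rwa [Complex.norm_conj]
  have hc₂ : ‖(starRingEnd ℂ) w₂‖ < 1 := by rwa [Complex.norm_conj]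
  calc ∫⁻ z in (ball (0 : ℂ) 1)ᶜ, ENNReal.ofReal (‖(z - w₁)⁻¹ - (z - w₂)⁻¹‖ ^ 2)
      = ∫⁻ z in (closedBall (0 : ℂ) 1)ᶜ, ENNReal.ofReal (‖(z - w₁)⁻¹ - (z - w₂)⁻¹‖ ^ 2) :=
        setLIntegral_congr hae.symm
    _ ≤ ∫⁻ z in (fun z : ℂ => z⁻¹) '' (ball 0 1 \ {0}),
          ENNReal.ofReal (‖(z - w₁)⁻¹ - (z - w₂)⁻¹‖ ^ 2) := lintegral_mono_set himg
    -- Inversion moves the exterior into the disk, and multiplication by its derivative turns the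
    -- integrand into the kernel of the conjugate points, up to sign.
    _ = ∫⁻ z in ball (0 : ℂ) 1 \ {0}, ENNReal.ofReal (‖-(z ^ 2)⁻¹‖ ^ 2) *
          ENNReal.ofReal (‖(z⁻¹ - w₁)⁻¹ - (z⁻¹ - w₂)⁻¹‖ ^ 2) := by
        refine lintegral_image_eq_lintegral_norm_deriv_sq_mul
          (measurableSet_ball.diff (measurableSet_singleton 0)) (fun z hz => hasDerivAt_inv hz.2)
          inv_injective.injOn _
    _ = ∫⁻ z in ball (0 : ℂ) 1 \ {0}, ENNReal.ofReal
          (‖kernelDeriv ((starRingEnd ℂ) w₁) ((starRingEnd ℂ) w₂) z‖ ^ 2) := by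
        refine setLIntegral_congr_fun (measurableSet_ball.diff (measurableSet_singleton 0))
          fun z hz => ?_
        have hz0 : z ≠ 0 := hz.2
        have hz1 : ‖z‖ < 1 := by simpa using hz.1
        have hd : ∀ w : ℂ, ‖w‖ < 1 → 1 - w * z ≠ 0 := fun w hw => by
          refine one_sub_ne_zero_of_norm_lt_one ?_
          rw [norm_mul]
          nlinarith [norm_nonneg w, norm_nonneg z]
        have hd1 := hd w₁ h₁
        have hd2 := hd w₂ h₂
        have hi : ∀ w : ℂ, ‖w‖ < 1 → (z⁻¹ - w)⁻¹ = z / (1 - w * z) := fun w hw => by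
          rw [show z⁻¹ - w = (1 - w * z) / z by field_simp, inv_div]
        rw [← ENNReal.ofReal_mul (by positivity), ← mul_pow, ← norm_mul, hi w₁ h₁, hi w₂ h₂]
        unfold kernelDeriv
        rw [Complex.conj_conj, Complex.conj_conj, ← norm_neg]
        congr 2
        rw [div_sub_div _ _ hd1 hd2, div_sub_div _ _ hd1 hd2, neg_mul, neg_neg, ← mul_div_assoc]
        congr 1
        field_simp
        ring
    _ ≤ ∫⁻ z in ball (0 : ℂ) 1, ENNReal.ofReal
          (‖kernelDeriv ((starRingEnd ℂ) w₁) ((starRingEnd ℂ) w₂) z‖ ^ 2) :=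
        lintegral_mono_set sdiff_subset
    _ = ENNReal.ofReal (Real.pi * logKernel w₁ w₂) := by
        rw [← logKernel_conj, ← setIntegral_norm_sq_kernelDeriv hc₁ hc₂,
          ofReal_integral_eq_lintegral_ofReal]
        · obtain ⟨R, hR, hR₁, hR₂⟩ := exists_radius_mul_norm_lt_one hc₁ hc₂
          have : ContinuousOn (fun z => ‖kernelDeriv ((starRingEnd ℂ) w₁) ((starRingEnd ℂ) w₂) z‖ ^ 2)
              (closedBall 0 1) :=
            ((differentiableOn_kernelDeriv hR₁ hR₂).continuousOn.mono
              (closedBall_subset_ball hR)).norm.pow 2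
          exact (this.integrableOn_compact (isCompact_closedBall 0 1)).mono_set ball_subset_closedBall
        · exact Filter.Eventually.of_forall fun z => by positivity

/-! ### Logarithmic area of annuli and Apollonius regions. -/

open MeasureTheory Metric Set Real in
/-- The logarithmic area of an annulus. -/
theorem lintegral_annulus_inv_norm_sq {m M : ℝ} (hm : 0 < m) (hM : m ≤ M) :
    ∫⁻ t in {t : ℂ | m < ‖t‖ ∧ ‖t‖ < M}, ENNReal.ofReal ((‖t‖ ^ 2)⁻¹) =
      ENNReal.ofReal (2 * π * log (M / m)) := by
  have hms : MeasurableSet {t : ℂ | m < ‖t‖ ∧ ‖t‖ < M} :=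
    (measurableSet_lt measurable_const measurable_norm).inter
      (measurableSet_lt measurable_norm measurable_const)
  have hI : IntegrableOn (fun r : ℝ => r⁻¹) (Ioo m M) := by
    refine (ContinuousOn.integrableOn_Icc ?_).mono_set Ioo_subset_Icc_self
    exact continuousOn_inv₀.mono fun x hx => (hm.trans_le hx.1).ne'
  rw [← lintegral_indicator hms, ← Complex.lintegral_comp_polarCoord_symm]
  have hsub : Ioo m M ×ˢ Ioo (-π) π ⊆ polarCoord.target := by
    rintro ⟨r, t⟩ ⟨h1, h2⟩
    exact ⟨hm.trans h1.1, h2⟩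
  calc ∫⁻ p in polarCoord.target, ENNReal.ofReal p.1 • {t : ℂ | m < ‖t‖ ∧ ‖t‖ < M}.indicator
          (fun t => ENNReal.ofReal ((‖t‖ ^ 2)⁻¹)) (Complex.polarCoord.symm p)
      = ∫⁻ p in polarCoord.target, (Ioo m M ×ˢ Ioo (-π) π).indicator
          (fun p => ENNReal.ofReal p.1⁻¹) p := by
        refine setLIntegral_congr_fun polarCoord.open_target.measurableSet fun p hp => ?_
        have hp0 : 0 < p.1 := hp.1
        have hn : ‖Complex.polarCoord.symm p‖ = p.1 := by
          rw [Complex.norm_polarCoord_symm, abs_of_pos hp0]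
        by_cases h : m < p.1 ∧ p.1 < M
        · rw [indicator_of_mem (show Complex.polarCoord.symm p ∈ {t : ℂ | m < ‖t‖ ∧ ‖t‖ < M} by
            simpa only [mem_ofPred_eq, hn] using h), indicator_of_mem (show p ∈ Ioo m M ×ˢ Ioo (-π) π from ⟨h, hp.2⟩), hn, smul_eq_mul,
            ← ENNReal.ofReal_mul hp0.le]
          congr 1
          field_simp
        · rw [indicator_of_notMem (show Complex.polarCoord.symm p ∉ {t : ℂ | m < ‖t‖ ∧ ‖t‖ < M} by
            simpa only [mem_ofPred_eq, hn] using h), indicator_of_notMem (fun h' => h h'.1), smul_zero]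
    _ = ∫⁻ p in Ioo m M ×ˢ Ioo (-π) π, ENNReal.ofReal p.1⁻¹ := by
        rw [setLIntegral_indicator (measurableSet_Ioo.prod measurableSet_Ioo),
          inter_eq_self_of_subset_left hsub]
    _ = ∫⁻ r in Ioo m M, ∫⁻ _ in Ioo (-π) π, ENNReal.ofReal r⁻¹ := by
        rw [Measure.volume_eq_prod, ← Measure.prod_restrict, lintegral_prod]
        exact (by fun_prop : Measurable fun p : ℝ × ℝ => ENNReal.ofReal p.1⁻¹).aemeasurable
    _ = (∫⁻ r in Ioo m M, ENNReal.ofReal r⁻¹) * ENNReal.ofReal (2 * π) := by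
        rw [← lintegral_mul_const _ (by fun_prop)]
        refine lintegral_congr fun r => ?_
        rw [lintegral_const, Measure.restrict_apply_univ, Real.volume_Ioo]
        congr 2
        ring
    _ = ENNReal.ofReal (2 * π * log (M / m)) := by
        rw [← ofReal_integral_eq_lintegral_ofReal hI, ← integral_Ioc_eq_integral_Ioo,
          ← intervalIntegral.integral_of_le hM, integral_inv_of_pos hm (hm.trans_le hM),
          ← ENNReal.ofReal_mul, mul_comm]
        · exact log_nonneg ((one_le_div hm).2 hM)
        · refine (ae_restrict_iff' measurableSet_Ioo).2 (ae_of_all _ fun r hr => ?_)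
          exact (inv_pos.2 (hm.trans hr.1)).le

/-- The region where the modulus of `(z - w₁) / (z - w₂)` lies between `ε` and `1 / ε`. -/
def apolloniusRegion (w₁ w₂ : ℂ) (ε : ℝ) : Set ℂ :=
  {z | ε < ‖(z - w₁) / (z - w₂)‖ ∧ ‖(z - w₁) / (z - w₂)‖ < ε⁻¹}

theorem measurableSet_apolloniusRegion (w₁ w₂ : ℂ) (ε : ℝ) :
    MeasurableSet (apolloniusRegion w₁ w₂ ε) := by
  have h : Measurable fun z : ℂ => ‖(z - w₁) / (z - w₂)‖ := by fun_prop
  exact (measurableSet_lt measurable_const h).inter (measurableSet_lt h measurable_const)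

theorem ne_of_mem_apolloniusRegion {w₁ w₂ z : ℂ} {ε : ℝ} (hε : 0 < ε)
    (hz : z ∈ apolloniusRegion w₁ w₂ ε) : z ≠ w₁ ∧ z ≠ w₂ := by
  -- Division by zero gives 0, so the lower bound `ε` excludes `w₂` as well as `w₁`.
  constructor <;> rintro rfl
  · have := hz.1
    simp at this
    linarith
  · have := hz.1
    simp at this
    linarith

theorem apolloniusRegion_comm (w₁ w₂ : ℂ) {ε : ℝ} (hε : 0 < ε) :
    apolloniusRegion w₁ w₂ ε = apolloniusRegion w₂ w₁ ε := by
  have key : ∀ w₁ w₂ : ℂ, apolloniusRegion w₁ w₂ ε ⊆ apolloniusRegion w₂ w₁ ε := by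
    intro w₁ w₂ z hz
    have h0 : 0 < ‖(z - w₁) / (z - w₂)‖ := hε.trans hz.1
    unfold apolloniusRegion
    rw [Set.mem_ofPred_eq, ← inv_div, norm_inv]
    exact ⟨(lt_inv_comm₀ hε h0).2 hz.2, (inv_lt_inv₀ h0 hε).2 hz.1⟩
  exact (key w₁ w₂).antisymm (key w₂ w₁)

theorem hasDerivAt_sub_div_sub {w₁ w₂ z : ℂ} (h₁ : z ≠ w₁) (h₂ : z ≠ w₂) :
    HasDerivAt (fun z => (z - w₁) / (z - w₂))
      ((z - w₁) / (z - w₂) * ((z - w₁)⁻¹ - (z - w₂)⁻¹)) z := by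
  have h1 := sub_ne_zero.2 h₁
  have h2 := sub_ne_zero.2 h₂
  refine (((hasDerivAt_id z).sub_const w₁).div ((hasDerivAt_id z).sub_const w₂) h2).congr_deriv ?_
  simp only [id]
  field_simp

theorem injOn_sub_div_sub {w₁ w₂ : ℂ} (h : w₁ ≠ w₂) :
    Set.InjOn (fun z => (z - w₁) / (z - w₂)) {z | z ≠ w₂} := by
  intro x hx y hy hxy
  have hx' := sub_ne_zero.2 hx
  have hy' := sub_ne_zero.2 hy
  simp only [div_eq_div_iff hx' hy'] at hxy
  have : (x - y) * (w₁ - w₂) = 0 := by linear_combination hxy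
  exact sub_eq_zero.1 ((mul_eq_zero.1 this).resolve_right (sub_ne_zero.2 h))

-- The Möbius map carries the region onto an annulus without the point 1, which is its value at
-- infinity, and `|(z - w₁)⁻¹ - (z - w₂)⁻¹|²` is the pullback of the logarithmic area density.
open MeasureTheory Set Real in
theorem lintegral_apolloniusRegion {w₁ w₂ : ℂ} (h : w₁ ≠ w₂) {ε : ℝ} (hε : 0 < ε) (hε1 : ε ≤ 1) :
    ∫⁻ z in apolloniusRegion w₁ w₂ ε, ENNReal.ofReal (‖(z - w₁)⁻¹ - (z - w₂)⁻¹‖ ^ 2) =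
      ENNReal.ofReal (4 * π * log ε⁻¹) := by
  have himg : (fun z => (z - w₁) / (z - w₂)) '' apolloniusRegion w₁ w₂ ε =ᵐ[volume]
      {t : ℂ | ε < ‖t‖ ∧ ‖t‖ < ε⁻¹} := by
    have : (fun z => (z - w₁) / (z - w₂)) '' apolloniusRegion w₁ w₂ ε =
        {t : ℂ | ε < ‖t‖ ∧ ‖t‖ < ε⁻¹} \ {1} := by
      ext t
      constructor
      · rintro ⟨z, hz, rfl⟩
        refine ⟨hz, fun h1 => h ?_⟩
        have h2 := sub_ne_zero.2 (ne_of_mem_apolloniusRegion hε hz).2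
        have := (div_eq_one_iff_eq h2).1 h1
        linear_combination -this
      · rintro ⟨ht, ht1⟩
        have ht1' : 1 - t ≠ 0 := fun e => ht1 (sub_eq_zero.1 e).symm
        have hw := sub_ne_zero.2 h
        have e1 : ((w₁ - t * w₂) / (1 - t) - w₁) = t * (w₁ - w₂) / (1 - t) := by
          field_simp
          ring
        have e2 : ((w₁ - t * w₂) / (1 - t) - w₂) = (w₁ - w₂) / (1 - t) := by
          field_simp
          ring
        have e : ((w₁ - t * w₂) / (1 - t) - w₁) / ((w₁ - t * w₂) / (1 - t) - w₂) = t := by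
          rw [e1, e2]
          field_simp
        refine ⟨(w₁ - t * w₂) / (1 - t), ?_, e⟩
        unfold apolloniusRegion
        rw [mem_ofPred_eq, e]
        exact ht
    rw [this]
    exact sdiff_null_ae_eq_self (measure_singleton 1)
  calc ∫⁻ z in apolloniusRegion w₁ w₂ ε, ENNReal.ofReal (‖(z - w₁)⁻¹ - (z - w₂)⁻¹‖ ^ 2)
      = ∫⁻ z in apolloniusRegion w₁ w₂ ε,
          ENNReal.ofReal (‖(z - w₁) / (z - w₂) * ((z - w₁)⁻¹ - (z - w₂)⁻¹)‖ ^ 2) *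
          ENNReal.ofReal ((‖(z - w₁) / (z - w₂)‖ ^ 2)⁻¹) := by
        refine setLIntegral_congr_fun (measurableSet_apolloniusRegion w₁ w₂ ε) fun z hz => ?_
        have : 0 < ‖(z - w₁) / (z - w₂)‖ := hε.trans hz.1
        rw [← ENNReal.ofReal_mul (by positivity), norm_mul, mul_pow]
        congr 1
        field_simp
    _ = ∫⁻ t in (fun z => (z - w₁) / (z - w₂)) '' apolloniusRegion w₁ w₂ ε,
          ENNReal.ofReal ((‖t‖ ^ 2)⁻¹) := by
        refine (lintegral_image_eq_lintegral_norm_deriv_sq_mul (measurableSet_apolloniusRegion w₁ w₂ ε)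
          (fun z hz => ?_) ((injOn_sub_div_sub h).mono fun z hz => ?_)
          (fun t => ENNReal.ofReal ((‖t‖ ^ 2)⁻¹))).symm
        · have := ne_of_mem_apolloniusRegion hε hz
          exact hasDerivAt_sub_div_sub this.1 this.2
        · exact (ne_of_mem_apolloniusRegion hε hz).2
    _ = ENNReal.ofReal (4 * π * log ε⁻¹) := by
        rw [setLIntegral_congr himg, lintegral_annulus_inv_norm_sq hε
          (hε1.trans ((one_le_inv₀ hε).2 hε1)), div_eq_mul_inv, log_mul (inv_pos.2 hε).ne'
          (inv_pos.2 hε).ne']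
        congr 1
        ring

open Metric Set Filter Topology in
/-- An injective map `(z - w₁) / (z - w₂) * exp A` does not shrink small Apollonius disks around `w₁`
by more than its linear part. -/
theorem eventually_lt_norm_of_mem_apolloniusRegion {A : ℂ → ℂ} (hA : DifferentiableOn ℂ A (ball 0 1))
    {w₁ w₂ : ℂ} (h : w₁ ≠ w₂) (h₁ : ‖w₁‖ < 1)
    (hinj : InjOn (fun z => (z - w₁) / (z - w₂) * Complex.exp (A z)) (ball 0 1 \ {w₂}))
    {η : ℝ} (hη : 0 < η) :
    ∀ᶠ ε in 𝓝[>] (0 : ℝ), ∀ z ∈ ball 0 1 ∩ apolloniusRegion w₁ w₂ ε,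
      ε * Real.exp ((A w₁).re - η) < ‖(z - w₁) / (z - w₂) * Complex.exp (A z)‖ := by
  set T : ℂ → ℂ := fun z => (z - w₁) / (z - w₂) * Complex.exp (A z) with hT
  have hU : IsOpen (ball (0 : ℂ) 1 \ {w₂}) := isOpen_ball.sdiff isClosed_singleton
  have hw₁ : w₁ ∈ ball (0 : ℂ) 1 \ {w₂} := ⟨by simpa using h₁, h⟩
  have hd : DifferentiableOn ℂ T (ball 0 1 \ {w₂}) := by
    refine DifferentiableOn.mul ?_ (hA.mono sdiff_subset).cexp
    exact DifferentiableOn.div (by fun_prop) (by fun_prop) fun z hz => sub_ne_zero.2 hz.2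
  have hmap : map T (𝓝 w₁) = 𝓝 (T w₁) :=
    ((hd.analyticAt (hU.mem_nhds hw₁)).hasStrictDerivAt).map_nhds_eq
      (deriv_ne_zero_of_injOn hU hd hinj hw₁)
  have hT0 : T w₁ = 0 := by simp [hT]
  have hcont : ContinuousAt (fun z => (A z).re) w₁ :=
    Complex.continuous_re.continuousAt.comp
      (hA.continuousOn.continuousAt (isOpen_ball.mem_nhds hw₁.1))
  have hN : {z | z ∈ ball (0 : ℂ) 1 \ {w₂} ∧ (A w₁).re - η < (A z).re} ∈ 𝓝 w₁ :=
    (hU.eventually_mem hw₁).and (hcont.eventually_const_lt (by linarith))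
  have hTN := image_mem_map (m := T) hN
  rw [hmap, hT0] at hTN
  obtain ⟨c, hc, hball⟩ := Metric.mem_nhds_iff.1 hTN
  have hsmall : ∀ᶠ ε in 𝓝[>] (0 : ℝ), ε * Real.exp ((A w₁).re - η) < c := by
    have : Tendsto (fun ε : ℝ => ε * Real.exp ((A w₁).re - η)) (𝓝[>] 0) (𝓝 0) := by
      have : Tendsto (fun ε : ℝ => ε * Real.exp ((A w₁).re - η)) (𝓝 0) (𝓝 (0 * _)) :=
        tendsto_id.mul_const _
      rw [zero_mul] at this
      exact this.mono_left nhdsWithin_le_nhds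
    exact this.eventually_lt_const hc
  filter_upwards [hsmall, self_mem_nhdsWithin] with ε hεc hε z hz
  -- A value this small is attained at some point near `w₁`, which injectivity identifies with `z`.
  -- But near `w₁` the real part of `A` exceeds `(A w₁).re - η`, so the value cannot be this small.
  by_contra! hle
  have hzb : T z ∈ ball (0 : ℂ) c := by
    rw [mem_ball_zero_iff]
    exact hle.trans_lt hεc
  obtain ⟨z', ⟨hz'U, hz'A⟩, hz'⟩ := hball hzb
  have hzU : z ∈ ball (0 : ℂ) 1 \ {w₂} := ⟨hz.1, (ne_of_mem_apolloniusRegion hε hz.2).2⟩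
  obtain rfl := hinj hz'U hzU hz'
  rw [norm_mul, Complex.norm_exp] at hle
  have h1 := hz.2.1
  have h2 := Real.exp_lt_exp.2 hz'A
  have : ε * Real.exp ((A w₁).re - η) < ‖(z' - w₁) / (z' - w₂)‖ * Real.exp (A z').re :=
    mul_lt_mul'' h1 h2 (le_of_lt hε) (Real.exp_pos _).le
  linarith

-- Exchanging `w₁, w₂` and replacing `A` by `-A` inverts the map. The lower bound near `w₁` thereby
-- also yields the upper bound near `w₂`.
open Set in
theorem injOn_swap {A : ℂ → ℂ} {w₁ w₂ : ℂ} {U : Set ℂ}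
    (hinj : InjOn (fun z => (z - w₁) / (z - w₂) * Complex.exp (A z)) (U \ {w₂})) :
    InjOn (fun z => (z - w₂) / (z - w₁) * Complex.exp ((-A) z)) (U \ {w₁}) := by
  have hinv : ∀ z, (z - w₂) / (z - w₁) * Complex.exp ((-A) z) =
      ((z - w₁) / (z - w₂) * Complex.exp (A z))⁻¹ := by
    intro z
    rw [mul_inv, inv_div, Pi.neg_apply, Complex.exp_neg]
  have hzero : ∀ x y, y ≠ w₁ → (w₂ - w₂) / (w₂ - w₁) * Complex.exp ((-A) x) =
      (y - w₂) / (y - w₁) * Complex.exp ((-A) y) → w₂ = y := by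
    intro x y hy he
    rw [sub_self, zero_div, zero_mul, eq_comm, mul_eq_zero, or_iff_left (Complex.exp_ne_zero _),
      div_eq_zero_iff, or_iff_left (sub_ne_zero.2 hy)] at he
    exact (sub_eq_zero.1 he).symm
  intro x hx y hy hxy
  rcases eq_or_ne x w₂ with rfl | hx2
  · exact hzero _ y hy.2 hxy
  rcases eq_or_ne y w₂ with rfl | hy2
  · exact (hzero _ x hx.2 hxy.symm).symm
  · simp only [hinv, inv_inj] at hxy
    exact hinj ⟨hx.1, hx2⟩ ⟨hy.1, hy2⟩ hxy

/-! ### The area inequality. -/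

open MeasureTheory Metric Set Filter Topology in
theorem tendsto_setIntegral_inter_apolloniusRegion {E : Type*} [NormedAddCommGroup E]
    [NormedSpace ℝ E] {F : ℂ → E} {U : Set ℂ} (hF : IntegrableOn F U) (w₁ w₂ : ℂ) :
    Tendsto (fun ε => ∫ z in U ∩ apolloniusRegion w₁ w₂ ε, F z) (𝓝[>] (0 : ℝ)) (𝓝 (∫ z in U, F z)) := by
  have heq : ∀ ε, ∫ z in U ∩ apolloniusRegion w₁ w₂ ε, F z =
      ∫ z in U, (apolloniusRegion w₁ w₂ ε).indicator F z := fun ε =>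
    (setIntegral_indicator (measurableSet_apolloniusRegion w₁ w₂ ε)).symm
  simp_rw [heq]
  refine tendsto_integral_filter_of_dominated_convergence (fun z => ‖F z‖) ?_ ?_ hF.norm ?_
  · exact Eventually.of_forall fun ε =>
      hF.aestronglyMeasurable.indicator (measurableSet_apolloniusRegion w₁ w₂ ε)
  · exact Eventually.of_forall fun ε => ae_of_all _ fun z => norm_indicator_le_norm_self _ _
  · have hne : ∀ᵐ z : ℂ ∂(volume.restrict U), z ≠ w₁ ∧ z ≠ w₂ := by
      refine ae_restrict_of_ae ?_
      have : ∀ w : ℂ, ∀ᵐ z : ℂ, z ≠ w := fun w => by simp [ae_iff, measure_singleton]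
      exact (this w₁).and (this w₂)
    filter_upwards [hne] with z hz
    refine tendsto_const_nhds.congr' ?_
    have hpos : 0 < ‖(z - w₁) / (z - w₂)‖ :=
      norm_pos_iff.2 (div_ne_zero (sub_ne_zero.2 hz.1) (sub_ne_zero.2 hz.2))
    have h1 : ∀ᶠ ε in 𝓝[>] (0 : ℝ), ε < ‖(z - w₁) / (z - w₂)‖ :=
      (eventually_lt_nhds hpos).filter_mono nhdsWithin_le_nhds
    have h2 : ∀ᶠ ε in 𝓝[>] (0 : ℝ), ‖(z - w₁) / (z - w₂)‖ < ε⁻¹ :=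
      tendsto_inv_nhdsGT_zero.eventually_gt_atTop _
    filter_upwards [h1, h2] with ε h1 h2
    exact (indicator_of_mem (show z ∈ apolloniusRegion w₁ w₂ ε from ⟨h1, h2⟩) F).symm

-- With `b = T'/T`, the left side is the logarithmic area of the image of `T`, by injectivity, and
-- the image lies in an annulus.
open MeasureTheory Metric Set in
theorem lintegral_logDeriv_le {U : Set ℂ} {T b : ℂ → ℂ} (hU : MeasurableSet U)
    (hT : ∀ z ∈ U, HasDerivAt T (T z * b z) z) (hinj : InjOn T U) {m M : ℝ} (hm : 0 < m) (hmM : m ≤ M)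
    (hlow : ∀ z ∈ U, m < ‖T z‖) (hup : ∀ z ∈ U, ‖T z‖ < M) :
    ∫⁻ z in U, ENNReal.ofReal (‖b z‖ ^ 2) ≤ ENNReal.ofReal (2 * Real.pi * Real.log (M / m)) := by
  calc ∫⁻ z in U, ENNReal.ofReal (‖b z‖ ^ 2)
      = ∫⁻ z in U, ENNReal.ofReal (‖T z * b z‖ ^ 2) * ENNReal.ofReal ((‖T z‖ ^ 2)⁻¹) := by
        refine setLIntegral_congr_fun hU fun z hz => ?_
        have : 0 < ‖T z‖ := hm.trans (hlow z hz)
        rw [← ENNReal.ofReal_mul (by positivity), norm_mul, mul_pow]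
        congr 1
        field_simp
    _ = ∫⁻ t in T '' U, ENNReal.ofReal ((‖t‖ ^ 2)⁻¹) :=
        (lintegral_image_eq_lintegral_norm_deriv_sq_mul hU hT hinj
          (fun t => ENNReal.ofReal ((‖t‖ ^ 2)⁻¹))).symm
    _ ≤ ∫⁻ t in {t : ℂ | m < ‖t‖ ∧ ‖t‖ < M}, ENNReal.ofReal ((‖t‖ ^ 2)⁻¹) := by
        refine lintegral_mono_set ?_
        rintro _ ⟨z, hz, rfl⟩
        exact ⟨hlow z hz, hup z hz⟩
    _ = _ := lintegral_annulus_inv_norm_sq hm hmM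

open MeasureTheory Metric Set Filter Topology Real in
/-- The area inequality: the Dirichlet integral of `A` is bounded by the logarithmic kernel if
`(z - w₁) / (z - w₂) * exp (A z)` is injective. -/
theorem setIntegral_norm_sq_le_logKernel {a A : ℂ → ℂ} {R : ℝ} (hR : 1 < R)
    (hA : ∀ z ∈ ball (0 : ℂ) R, HasDerivAt A (a z) z) (ha : DifferentiableOn ℂ a (ball 0 R))
    {w₁ w₂ : ℂ} (h : w₁ ≠ w₂) (h₁ : ‖w₁‖ < 1) (h₂ : ‖w₂‖ < 1)
    (hinj : InjOn (fun z => (z - w₁) / (z - w₂) * Complex.exp (A z)) (ball 0 1 \ {w₂})) :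
    ∫ z in ball (0 : ℂ) 1, ‖a z‖ ^ 2 ≤ π * logKernel w₁ w₂ := by
  set D := ball (0 : ℂ) 1
  set q : ℂ → ℂ := fun z => (z - w₁)⁻¹ - (z - w₂)⁻¹ with hq
  have hqm : Measurable q := by fun_prop
  have hac : ContinuousOn a (closedBall 0 1) := ha.continuousOn.mono (closedBall_subset_ball hR)
  have haint : IntegrableOn (fun z => ‖a z‖ ^ 2) D :=
    ((hac.norm.pow 2).integrableOn_compact (isCompact_closedBall 0 1)).mono_set ball_subset_closedBall
  have hqaint : IntegrableOn (fun z => a z * (starRingEnd ℂ) (q z)) D := by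
    have := (integrableOn_mul_conj_inv_sub hR ha w₁).sub (integrableOn_mul_conj_inv_sub hR ha w₂)
    refine this.congr (ae_of_all _ fun z => ?_)
    simp only [hq, map_sub, mul_sub, Pi.sub_apply]
  have hcross : ∫ z in D, a z * (starRingEnd ℂ) (q z) = -π * (A w₁ - A w₂) := by
    simp only [hq, map_sub, mul_sub]
    rw [integral_sub (integrableOn_mul_conj_inv_sub hR ha w₁) (integrableOn_mul_conj_inv_sub hR ha w₂),
      setIntegral_mul_conj_inv_sub_of_norm_lt_one hR hA ha h₁,
      setIntegral_mul_conj_inv_sub_of_norm_lt_one hR hA ha h₂]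
    ring
  have hAd : DifferentiableOn ℂ A D := fun z hz =>
    (hA z (ball_subset_ball hR.le hz)).differentiableAt.differentiableWithinAt
  -- Expand `|q + a|²`, where `q + a = T'/T`. The upper bound for its integral and the lower bound
  -- for that of `|q|²` both contain `4π log ε⁻¹`, which cancels.
  have key : ∀ η > 0, ∀ᶠ ε in 𝓝[>] (0 : ℝ),
      (∫ z in D ∩ apolloniusRegion w₁ w₂ ε, ‖a z‖ ^ 2) +
        2 * (∫ z in D ∩ apolloniusRegion w₁ w₂ ε, a z * (starRingEnd ℂ) (q z)).re ≤
      π * logKernel w₁ w₂ + 2 * π * ((A w₂).re - (A w₁).re + 2 * η) := by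
    intro η hη
    have hup := eventually_lt_norm_of_mem_apolloniusRegion hAd.neg h.symm h₂ (injOn_swap hinj) hη
    have hlt : ∀ᶠ ε in 𝓝[>] (0 : ℝ), ε < 1 :=
      (eventually_lt_nhds one_pos).filter_mono nhdsWithin_le_nhds
    have hlt' : ∀ᶠ ε in 𝓝[>] (0 : ℝ),
        ε * exp ((A w₁).re - η) ≤ (ε * exp (-(A w₂).re - η))⁻¹ := by
      have : Tendsto (fun ε : ℝ => ε * exp ((A w₁).re - η) * (ε * exp (-(A w₂).re - η))) (𝓝[>] 0)
          (𝓝 0) := by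
        have : Tendsto (fun ε : ℝ => ε * exp ((A w₁).re - η) * (ε * exp (-(A w₂).re - η))) (𝓝 0)
            (𝓝 (0 * exp ((A w₁).re - η) * (0 * exp (-(A w₂).re - η)))) := by
          exact Continuous.tendsto (by fun_prop) 0
        rw [zero_mul, zero_mul] at this
        exact this.mono_left nhdsWithin_le_nhds
      filter_upwards [this.eventually_lt_const one_pos, self_mem_nhdsWithin] with ε h1 h2
      have : 0 < ε * exp (-(A w₂).re - η) := mul_pos h2 (exp_pos _)
      rw [← one_div, le_div_iff₀ this]
      exact h1.le
    filter_upwards [eventually_lt_norm_of_mem_apolloniusRegion hAd h h₁ hinj hη, hup, hlt, hlt',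
      self_mem_nhdsWithin] with ε hlow hup hε1 hmM hε
    have hε0 : 0 < ε := hε
    set X := D ∩ apolloniusRegion w₁ w₂ ε with hX
    have hXm : MeasurableSet X := measurableSet_ball.inter (measurableSet_apolloniusRegion w₁ w₂ ε)
    have hXD : X ⊆ D := inter_subset_left
    have hXne : ∀ z ∈ X, z ≠ w₁ ∧ z ≠ w₂ := fun z hz => ne_of_mem_apolloniusRegion hε0 hz.2
    have hderiv : ∀ z ∈ X, HasDerivAt (fun z => (z - w₁) / (z - w₂) * Complex.exp (A z))
        ((z - w₁) / (z - w₂) * Complex.exp (A z) * (q z + a z)) z := by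
      intro z hz
      refine ((hasDerivAt_sub_div_sub (hXne z hz).1 (hXne z hz).2).mul
        (hA z (ball_subset_ball hR.le hz.1)).cexp).congr_deriv ?_
      simp only [hq]
      ring
    have hpos : 0 < ε * exp (-(A w₂).re - η) := mul_pos hε0 (exp_pos _)
    have harea := lintegral_logDeriv_le hXm hderiv
      (hinj.mono fun z hz => (⟨hz.1, (hXne z hz).2⟩ : z ∈ D \ {w₂})) (mul_pos hε0 (exp_pos _)) hmM hlow
      (fun z hz => by
        have h1 := hup z (by rw [apolloniusRegion_comm _ _ hε0]; exact hz)
        have h2 : (z - w₂) / (z - w₁) * Complex.exp ((-A) z) =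
            ((z - w₁) / (z - w₂) * Complex.exp (A z))⁻¹ := by
          rw [mul_inv, inv_div, Pi.neg_apply, Complex.exp_neg]
        rw [h2, norm_inv] at h1
        simp only [Pi.neg_apply, Complex.neg_re] at h1
        have h3 : 0 < ‖(z - w₁) / (z - w₂) * Complex.exp (A z)‖ :=
          (mul_pos hε0 (exp_pos _)).trans (hlow z hz)
        exact (lt_inv_comm₀ hpos h3).1 h1)
    have hval : log ((ε * exp (-(A w₂).re - η))⁻¹ / (ε * exp ((A w₁).re - η))) =
        2 * log ε⁻¹ + ((A w₂).re - (A w₁).re + 2 * η) := by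
      have := (exp_pos (-(A w₂).re - η)).ne'
      have := (exp_pos ((A w₁).re - η)).ne'
      rw [log_div (by positivity) (by positivity), log_inv, log_mul (by positivity) (by positivity),
        log_mul (by positivity) (by positivity), log_exp, log_exp, log_inv]
      ring
    rw [hval] at harea
    -- The integral over the full Apollonius region is known exactly, and the part outside the disk
    -- costs at most `π * logKernel w₁ w₂`.
    have hqfull : ENNReal.ofReal (4 * π * log ε⁻¹) ≤
        (∫⁻ z in X, ENNReal.ofReal (‖q z‖ ^ 2)) + ENNReal.ofReal (π * logKernel w₁ w₂) := by
      rw [← lintegral_apolloniusRegion h hε0 hε1.le]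
      refine le_trans (lintegral_mono_set (t := X ∪ Dᶜ) fun z hz => ?_)
        ((lintegral_union_le _ _ _).trans ?_)
      · by_cases hzD : z ∈ D
        · exact Or.inl ⟨hzD, hz⟩
        · exact Or.inr hzD
      · gcongr
        exact lintegral_compl_ball_inv_sub_sub h₁ h₂
    have hqlt : ∫⁻ z in X, ENNReal.ofReal (‖q z‖ ^ 2) < ⊤ := by
      refine lt_of_le_of_lt (lintegral_mono_set inter_subset_right) ?_
      rw [lintegral_apolloniusRegion h hε0 hε1.le]
      exact ENNReal.ofReal_lt_top
    have hqint : IntegrableOn (fun z => ‖q z‖ ^ 2) X := by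
      refine ⟨(hqm.norm.pow_const 2).aestronglyMeasurable, ?_⟩
      rw [hasFiniteIntegral_iff_ofReal (ae_of_all _ fun z => by positivity)]
      exact hqlt
    have hKpos : 0 ≤ π * logKernel w₁ w₂ := by
      rw [← setIntegral_norm_sq_kernelDeriv h₁ h₂]
      exact integral_nonneg fun z => by positivity
    have hqreal : 4 * π * log ε⁻¹ ≤ (∫ z in X, ‖q z‖ ^ 2) + π * logKernel w₁ w₂ := by
      have h0 : 0 ≤ ∫ z in X, ‖q z‖ ^ 2 := integral_nonneg fun z => by positivity
      rw [← ofReal_integral_eq_lintegral_ofReal hqint (ae_of_all _ fun z => by positivity),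
        ← ENNReal.ofReal_add h0 hKpos, ENNReal.ofReal_le_ofReal_iff (add_nonneg h0 hKpos)] at hqfull
      exact hqfull
    have hexp : ∀ z, ‖q z + a z‖ ^ 2 =
        ‖q z‖ ^ 2 + 2 * (a z * (starRingEnd ℂ) (q z)).re + ‖a z‖ ^ 2 := by
      intro z
      rw [← Complex.normSq_eq_norm_sq, ← Complex.normSq_eq_norm_sq, ← Complex.normSq_eq_norm_sq,
        Complex.normSq_apply, Complex.normSq_apply, Complex.normSq_apply]
      simp
      ring
    have hcint : IntegrableOn (fun z => 2 * (a z * (starRingEnd ℂ) (q z)).re) X :=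
      ((hqaint.mono_set hXD).re).const_mul 2
    have haX := haint.mono_set hXD
    have hsumint : IntegrableOn (fun z => ‖q z + a z‖ ^ 2) X := by
      simp_rw [hexp]
      exact (hqint.add hcint).add haX
    have hareal : ∫ z in X, ‖q z + a z‖ ^ 2 ≤
        2 * π * (2 * log ε⁻¹ + ((A w₂).re - (A w₁).re + 2 * η)) := by
      have h0 : 0 ≤ ∫ z in X, ‖q z + a z‖ ^ 2 := integral_nonneg fun z => by positivity
      rw [← ofReal_integral_eq_lintegral_ofReal hsumint (ae_of_all _ fun z => by positivity)] at harea
      rw [ENNReal.ofReal_le_ofReal_iff'] at harea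
      rcases harea with h' | h'
      · exact h'
      · rw [← hval]
        refine h'.trans ?_
        refine mul_nonneg (by positivity) (log_nonneg ?_)
        rw [one_le_div (by positivity)]
        exact hmM
    have hsum : ∫ z in X, ‖q z + a z‖ ^ 2 = (∫ z in X, ‖q z‖ ^ 2) +
        2 * (∫ z in X, a z * (starRingEnd ℂ) (q z)).re + ∫ z in X, ‖a z‖ ^ 2 := by
      simp_rw [hexp]
      have hadd := integral_add (hqint.add hcint) haX
      simp only [Pi.add_apply] at hadd
      rw [hadd, integral_add hqint hcint, integral_const_mul]
      congr 3
      exact integral_re (hqaint.mono_set hXD)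
    linarith
  have hlim : Tendsto (fun ε => (∫ z in D ∩ apolloniusRegion w₁ w₂ ε, ‖a z‖ ^ 2) +
        2 * (∫ z in D ∩ apolloniusRegion w₁ w₂ ε, a z * (starRingEnd ℂ) (q z)).re) (𝓝[>] (0 : ℝ))
      (𝓝 ((∫ z in D, ‖a z‖ ^ 2) + 2 * (∫ z in D, a z * (starRingEnd ℂ) (q z)).re)) := by
    refine (tendsto_setIntegral_inter_apolloniusRegion haint w₁ w₂).add (Tendsto.const_mul 2 ?_)
    exact (Complex.continuous_re.tendsto _).comp
      (tendsto_setIntegral_inter_apolloniusRegion hqaint w₁ w₂)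
  have hre : (∫ z in D, a z * (starRingEnd ℂ) (q z)).re = -π * ((A w₁).re - (A w₂).re) := by
    rw [hcross, ← Complex.ofReal_neg, Complex.re_ofReal_mul, Complex.sub_re]
  refine le_of_forall_pos_le_add fun δ hδ => ?_
  -- The choice `η = δ / (4π)` makes the slack `4πη` equal to `δ`. The cross term cancels `2π ((A
  -- w₂).re - (A w₁).re)` on the right.
  have := le_of_tendsto hlim (key (δ / (4 * π)) (by positivity))
  rw [hre] at this
  have h4 : 2 * π * (2 * (δ / (4 * π))) = δ := by
    field_simp
    ring
  nlinarith

/-! ### Goluzin's inequality. -/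

-- `π (A z₁ - A z₂)` is the pairing of `a` with the kernel. The pointwise bound `xy ≤ (x² + y²)/2`
-- plays the role of Cauchy–Schwarz and produces the mean of the two `logKernel` values.
open MeasureTheory Metric Set Real in
theorem norm_sub_le_logKernel {a A : ℂ → ℂ} {R : ℝ} (hR : 1 < R)
    (hA : ∀ z ∈ ball (0 : ℂ) R, HasDerivAt A (a z) z) (ha : DifferentiableOn ℂ a (ball 0 R))
    {w₁ w₂ z₁ z₂ : ℂ} (h : w₁ ≠ w₂) (hw₁ : ‖w₁‖ < 1) (hw₂ : ‖w₂‖ < 1) (hz₁ : ‖z₁‖ < 1) (hz₂ : ‖z₂‖ < 1)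
    (hinj : InjOn (fun z => (z - w₁) / (z - w₂) * Complex.exp (A z)) (ball 0 1 \ {w₂})) :
    ‖A z₁ - A z₂‖ ≤ (logKernel w₁ w₂ + logKernel z₁ z₂) / 2 := by
  have h1 := setIntegral_norm_sq_le_logKernel hR hA ha h hw₁ hw₂ hinj
  have h2 := setIntegral_norm_sq_kernelDeriv hz₁ hz₂
  have h3 := setIntegral_mul_conj_kernelDeriv hR hA ha hz₁ hz₂
  obtain ⟨R', hR', hR₁, hR₂⟩ := exists_radius_mul_norm_lt_one hz₁ hz₂
  have hint : ∀ {F : ℂ → ℂ} {R : ℝ}, 1 < R → DifferentiableOn ℂ F (ball 0 R) →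
      IntegrableOn (fun z => ‖F z‖ ^ 2) (ball 0 1) := fun hR hF =>
    (((hF.continuousOn.mono (closedBall_subset_ball hR)).norm.pow 2).integrableOn_compact
      (isCompact_closedBall 0 1)).mono_set ball_subset_closedBall
  have ha2 := hint hR ha
  have hk2 := hint hR' (differentiableOn_kernelDeriv hR₁ hR₂)
  have hle : ‖∫ z in ball (0 : ℂ) 1, a z * (starRingEnd ℂ) (kernelDeriv z₁ z₂ z)‖ ≤
      ∫ z in ball (0 : ℂ) 1, (‖a z‖ ^ 2 + ‖kernelDeriv z₁ z₂ z‖ ^ 2) / 2 := by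
    refine norm_integral_le_of_norm_le ((ha2.add hk2).div_const 2) (ae_of_all _ fun z => ?_)
    rw [norm_mul, Complex.norm_conj]
    nlinarith [sq_nonneg (‖a z‖ - ‖kernelDeriv z₁ z₂ z‖)]
  rw [h3, integral_div, integral_add ha2 hk2, h2, norm_mul, Complex.norm_real, norm_eq_abs,
    abs_of_pos pi_pos] at hle
  have hpi := pi_pos
  have : π * ‖A z₁ - A z₂‖ ≤ π * ((logKernel w₁ w₂ + logKernel z₁ z₂) / 2) := by linarith
  exact le_of_mul_le_mul_left this hpi

-- `A` is a logarithm of the ratio of the difference quotients at `w₁` and `w₂`. Then `(z - w₁)/(z -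
-- w₂) * exp A` is a Möbius transform of `h`, hence injective. The radius `R > 1` makes `A`
-- holomorphic up to the unit circle.
open Metric Set in
theorem norm_dslope_mul_le_of_ball_one_lt {h : ℂ → ℂ} {R : ℝ} (hR : 1 < R)
    (hd : DifferentiableOn ℂ h (ball 0 R)) (hi : InjOn h (ball 0 R))
    {w₁ w₂ z₁ z₂ : ℂ} (hw : w₁ ≠ w₂) (hw₁ : ‖w₁‖ < 1) (hw₂ : ‖w₂‖ < 1) (hz₁ : ‖z₁‖ < 1)
    (hz₂ : ‖z₂‖ < 1) :
    ‖dslope h w₁ z₁‖ * ‖dslope h w₂ z₂‖ ≤ Real.exp ((logKernel w₁ w₂ + logKernel z₁ z₂) / 2) *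
      (‖dslope h w₁ z₂‖ * ‖dslope h w₂ z₁‖) := by
  have hmem : ∀ {z : ℂ}, ‖z‖ < 1 → z ∈ ball (0 : ℂ) R := fun hz => by
    rw [mem_ball_zero_iff]
    exact hz.trans hR
  have hne : ∀ {w z : ℂ}, w ∈ ball (0 : ℂ) R → z ∈ ball (0 : ℂ) R → dslope h w z ≠ 0 :=
    fun h1 h2 => dslope_ne_zero_of_injOn isOpen_ball hd hi h1 h2
  have hds : ∀ {w : ℂ}, w ∈ ball (0 : ℂ) R → DifferentiableOn ℂ (dslope h w) (ball 0 R) :=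
    fun h1 => (Complex.differentiableOn_dslope (isOpen_ball.mem_nhds h1)).2 hd
  obtain ⟨A, hAd, hA⟩ := exists_log_on_ball
    (E := fun z => dslope h w₁ z / dslope h w₂ z)
    ((hds (hmem hw₁)).div (hds (hmem hw₂)) fun z hz => hne (hmem hw₂) hz)
    (fun z hz => div_ne_zero (hne (hmem hw₁) hz) (hne (hmem hw₂) hz))
  have hT : ∀ z ∈ ball (0 : ℂ) R, z ≠ w₂ →
      (z - w₁) / (z - w₂) * Complex.exp (A z) = (h z - h w₁) / (h z - h w₂) := by
    intro z hz hzw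
    have h1 := sub_ne_zero.2 hzw
    have h2 := hne (hmem hw₂) hz
    rw [hA z hz, ← sub_smul_dslope h w₁ z, ← sub_smul_dslope h w₂ z, smul_eq_mul, smul_eq_mul,
      div_mul_div_comm]
  have hsub : ball (0 : ℂ) 1 ⊆ ball 0 R := ball_subset_ball hR.le
  have hinj : InjOn (fun z => (z - w₁) / (z - w₂) * Complex.exp (A z)) (ball 0 1 \ {w₂}) := by
    intro x hx y hy hxy
    simp only at hxy
    rw [hT x (hsub hx.1) hx.2, hT y (hsub hy.1) hy.2] at hxy
    refine hi (hsub hx.1) (hsub hy.1) (injOn_sub_div_sub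
      (fun e => hw (hi (hmem hw₁) (hmem hw₂) e)) ?_ ?_ hxy)
    · exact fun e => hx.2 (hi (hsub hx.1) (hmem hw₂) e)
    · exact fun e => hy.2 (hi (hsub hy.1) (hmem hw₂) e)
  have hb := norm_sub_le_logKernel hR
    (fun z hz => (hAd.differentiableAt (isOpen_ball.mem_nhds hz)).hasDerivAt) (hAd.deriv isOpen_ball)
    hw hw₁ hw₂ hz₁ hz₂ hinj
  have hre : (A z₁).re ≤ (logKernel w₁ w₂ + logKernel z₁ z₂) / 2 + (A z₂).re := by
    have := (Complex.re_le_norm (A z₁ - A z₂)).trans hb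
    rw [Complex.sub_re] at this
    linarith
  have hexp := Real.exp_le_exp.2 hre
  rw [Real.exp_add, ← Complex.norm_exp, ← Complex.norm_exp, hA z₁ (hmem hz₁), hA z₂ (hmem hz₂),
    norm_div, norm_div, ← mul_div_assoc,
    div_le_div_iff₀ (norm_pos_iff.2 (hne (hmem hw₂) (hmem hz₁)))
      (norm_pos_iff.2 (hne (hmem hw₂) (hmem hz₂)))] at hexp
  linarith

theorem dslope_comp_mul_left (h : ℂ → ℂ) {r : ℂ} (hr : r ≠ 0) (w z : ℂ) :
    dslope (fun z => h (r * z)) w z = r * dslope h (r * w) (r * z) := by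
  rcases eq_or_ne z w with rfl | hzw
  · rw [dslope_same, dslope_same, deriv_comp_mul_left, smul_eq_mul]
  · have h1 : r * z ≠ r * w := fun e => hzw (mul_left_cancel₀ hr e)
    have h2 := sub_ne_zero.2 hzw
    rw [dslope_of_ne _ hzw, dslope_of_ne _ h1, slope_def_field, slope_def_field, ← mul_sub]
    field_simp

open Metric Set Filter Topology in
/-- The Goluzin distortion inequality for injective holomorphic functions on the unit disk. -/
theorem norm_dslope_mul_le_of_injOn {h : ℂ → ℂ}
    (hd : DifferentiableOn ℂ h (ball 0 1)) (hi : InjOn h (ball 0 1))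
    {w₁ w₂ z₁ z₂ : ℂ} (hw : w₁ ≠ w₂) (hw₁ : ‖w₁‖ < 1) (hw₂ : ‖w₂‖ < 1) (hz₁ : ‖z₁‖ < 1)
    (hz₂ : ‖z₂‖ < 1) :
    ‖dslope h w₁ z₁‖ * ‖dslope h w₂ z₂‖ ≤ Real.exp ((logKernel w₁ w₂ + logKernel z₁ z₂) / 2) *
      (‖dslope h w₁ z₂‖ * ‖dslope h w₂ z₁‖) := by
  have hcont : ∀ {u v : ℂ}, ‖u‖ < 1 → ‖v‖ < 1 →
      ContinuousAt (fun s : ℝ => logKernel (s * u) (s * v)) 1 := by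
    intro u v hu hv
    have hu' : 0 < 1 - ‖u‖ ^ 2 := by nlinarith [norm_nonneg u]
    have hv' : 0 < 1 - ‖v‖ ^ 2 := by nlinarith [norm_nonneg v]
    have huv : 1 - (starRingEnd ℂ) v * u ≠ 0 := by
      refine one_sub_ne_zero_of_norm_lt_one ?_
      rw [norm_mul, Complex.norm_conj]
      nlinarith [norm_nonneg u, norm_nonneg v]
    have hc : Continuous (starRingEnd ℂ) := Complex.continuous_conj
    unfold logKernel
    refine ContinuousAt.log (ContinuousAt.div (by fun_prop) (by fun_prop) ?_) ?_
    · simp [hu'.ne', hv'.ne']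
    · simp only [Complex.ofReal_one, one_mul]
      have := norm_pos_iff.2 huv
      positivity
  have hev : ∀ {u : ℂ}, ‖u‖ < 1 → ∀ᶠ s : ℝ in 𝓝 1, ‖(s : ℂ) * u‖ < 1 := by
    intro u hu
    have : ContinuousAt (fun s : ℝ => ‖(s : ℂ) * u‖) 1 := by fun_prop
    exact this.eventually_lt_const (by simpa using hu)
  have hlim : Tendsto (fun s : ℝ => Real.exp ((logKernel (s * w₁) (s * w₂) +
      logKernel (s * z₁) (s * z₂)) / 2) * (‖dslope h w₁ z₂‖ * ‖dslope h w₂ z₁‖)) (𝓝[>] 1)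
      (𝓝 (Real.exp ((logKernel w₁ w₂ + logKernel z₁ z₂) / 2) *
      (‖dslope h w₁ z₂‖ * ‖dslope h w₂ z₁‖))) := by
    have : ContinuousAt (fun s : ℝ => Real.exp ((logKernel (s * w₁) (s * w₂) +
      logKernel (s * z₁) (s * z₂)) / 2) * (‖dslope h w₁ z₂‖ * ‖dslope h w₂ z₁‖)) 1 :=
      ((((hcont hw₁ hw₂).add (hcont hz₁ hz₂)).div_const 2).rexp).mul_const _
    have h2 := this.tendsto.mono_left (nhdsWithin_le_nhds (s := Ioi 1))
    simpa only [Complex.ofReal_one, one_mul] using h2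
  refine ge_of_tendsto hlim ?_
  filter_upwards [(hev hw₁).filter_mono nhdsWithin_le_nhds, (hev hw₂).filter_mono nhdsWithin_le_nhds,
    (hev hz₁).filter_mono nhdsWithin_le_nhds, (hev hz₂).filter_mono nhdsWithin_le_nhds,
    self_mem_nhdsWithin] with s h1 h2 h3 h4 hs
  have hs1 : (1 : ℝ) < s := hs
  have hs0 : (0 : ℝ) < s := by linarith
  have hsc : (s : ℂ) ≠ 0 := by exact_mod_cast hs0.ne'
  have hmaps : MapsTo (fun z : ℂ => (s : ℂ)⁻¹ * z) (ball 0 s) (ball 0 1) := by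
    intro z hz
    rw [mem_ball_zero_iff] at hz ⊢
    rw [norm_mul, norm_inv, Complex.norm_real, Real.norm_eq_abs, abs_of_pos hs0, inv_mul_lt_one₀ hs0]
    exact hz
  -- The dilation `h (z / s)` is injective on the disk of radius `s > 1`. At the points `s * wᵢ`, `s
  -- * zᵢ` it has the original difference quotients up to a common factor, and only the kernels
  -- depend on `s` as `s ↓ 1`.
  have key := norm_dslope_mul_le_of_ball_one_lt hs1 (h := fun z => h ((s : ℂ)⁻¹ * z))
    (hd.comp (by fun_prop) hmaps)
    (hi.comp (fun x _ y _ e => mul_left_cancel₀ (inv_ne_zero hsc) e) hmaps)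
    (fun e => hw (mul_left_cancel₀ hsc e)) h1 h2 h3 h4
  simp only [dslope_comp_mul_left h (inv_ne_zero hsc), inv_mul_cancel_left₀ hsc, norm_mul] at key
  have hpos : 0 < ‖(s : ℂ)⁻¹‖ := norm_pos_iff.2 (inv_ne_zero hsc)
  have hpos2 : 0 < ‖(s : ℂ)⁻¹‖ * ‖(s : ℂ)⁻¹‖ := mul_pos hpos hpos
  refine le_of_mul_le_mul_left ?_ hpos2
  linarith

/-! ### Koebe growth and a two-point distortion bound. -/

theorem logKernel_zero_right (w : ℂ) : logKernel w 0 = -Real.log (1 - ‖w‖ ^ 2) := by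
  simp [logKernel]

theorem logKernel_zero_left (w : ℂ) : logKernel 0 w = -Real.log (1 - ‖w‖ ^ 2) := by
  simp [logKernel]

theorem logKernel_neg_right (w : ℂ) :
    logKernel w (-w) = Real.log (((1 + ‖w‖ ^ 2) / (1 - ‖w‖ ^ 2)) ^ 2) := by
  have : 1 - (starRingEnd ℂ) (-w) * w = ((1 + ‖w‖ ^ 2 : ℝ) : ℂ) := by
    rw [map_neg, neg_mul, sub_neg_eq_add, mul_comm, Complex.mul_conj, Complex.normSq_eq_norm_sq]
    push_cast
    rfl
  unfold logKernel
  rw [this, Complex.norm_real, Real.norm_eq_abs, abs_of_nonneg (by positivity), norm_neg, div_pow,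
    sq (1 - ‖w‖ ^ 2)]

-- Goluzin's inequality at the pairs `(w, 0)` and `(0, z)`: both kernels equal `-log (1 - r²)`, and
-- `dslope h 0 0 = 1`.
open Metric Set in
theorem norm_mul_norm_le_norm_dslope {h : ℂ → ℂ} (hd : DifferentiableOn ℂ h (ball 0 1))
    (hi : InjOn h (ball 0 1)) (h0 : h 0 = 0) (h0' : deriv h 0 = 1) {w z : ℂ} {r : ℝ} (hr : 0 < r)
    (hr1 : r < 1) (hw : ‖w‖ = r) (hz : ‖z‖ = r) :
    (1 - r ^ 2) * (‖h w‖ * ‖h z‖) ≤ r ^ 2 * ‖dslope h w z‖ := by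
  have hw0 : w ≠ 0 := norm_pos_iff.1 (hw ▸ hr)
  have hz0 : z ≠ 0 := norm_pos_iff.1 (hz ▸ hr)
  have key := norm_dslope_mul_le_of_injOn hd hi (w₁ := w) (w₂ := 0) (z₁ := 0) (z₂ := z) hw0
    (hw ▸ hr1) (by simp) (by simp) (hz ▸ hr1)
  have hs : ∀ {x : ℂ}, x ≠ 0 → dslope h 0 x = h x / x := fun hx => by
    rw [dslope_of_ne _ hx, slope_def_field, h0, sub_zero, sub_zero]
  have hp : 0 < 1 - r ^ 2 := by nlinarith
  rw [logKernel_zero_right, logKernel_zero_left, hw, hz, add_self_div_two, Real.exp_neg,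
    Real.exp_log hp, dslope_same, h0', dslope_comm_field h w 0, hs hw0, hs hz0, norm_div, norm_div,
    hw, hz, norm_one, mul_one, div_mul_div_comm, inv_mul_eq_div, div_le_div_iff₀ (by positivity) hp] at key
  linarith

open Metric Set in
/-- The sharp upper bound for the logarithmic derivative of an injective holomorphic function. -/
theorem norm_mul_norm_deriv_le {m : ℂ → ℂ} (hd : DifferentiableOn ℂ m (ball 0 1))
    (hi : InjOn m (ball 0 1)) (h0 : m 0 = 0) {y : ℂ} (hy : ‖y‖ < 1) :
    (1 - ‖y‖) * (‖y‖ * ‖deriv m y‖) ≤ (1 + ‖y‖) * ‖m y‖ := by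
  rcases eq_or_ne y 0 with rfl | hy0
  · simp [h0]
  have hzero : (0 : ℂ) ∈ ball (0 : ℂ) 1 := mem_ball_self one_pos
  obtain ⟨A, hAd, hA⟩ := exists_log_on_ball
    ((Complex.differentiableOn_dslope (isOpen_ball.mem_nhds hzero)).2 hd)
    fun z hz => dslope_ne_zero_of_injOn isOpen_ball hd hi hzero hz
  have hsq : MapsTo (fun z : ℂ => z ^ 2) (ball 0 1) (ball 0 1) := by
    intro z hz
    rw [mem_ball_zero_iff] at hz ⊢
    rw [norm_pow]
    nlinarith [norm_nonneg z]
  -- The odd square root of `m (z ^ 2)`; the logarithm `A` of `m z / z` supplies the branch.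
  set k : ℂ → ℂ := fun z => z * Complex.exp (A (z ^ 2) / 2) with hk
  have hkd : DifferentiableOn ℂ k (ball 0 1) := by
    have : DifferentiableOn ℂ (fun z => A (z ^ 2)) (ball 0 1) := hAd.comp (by fun_prop) hsq
    exact differentiableOn_id.mul (this.div_const 2).cexp
  have hkm : ∀ z ∈ ball (0 : ℂ) 1, k z ^ 2 = m (z ^ 2) := by
    intro z hz
    have := sub_smul_dslope m 0 (z ^ 2)
    rw [h0, sub_zero, sub_zero, smul_eq_mul] at this
    rw [← this, ← hA _ (hsq hz), hk, mul_pow, ← Complex.exp_nat_mul]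
    congr 2
    push_cast
    ring
  have hkneg : ∀ z, k (-z) = -k z := fun z => by simp [hk]
  have hkzero : ∀ z, k z = 0 → z = 0 := fun z hz => by simpa [hk] using hz
  have hki : InjOn k (ball 0 1) := by
    intro x hx z hz hxz
    have h1 : x ^ 2 = z ^ 2 := hi (hsq hx) (hsq hz) (by rw [← hkm x hx, ← hkm z hz, hxz])
    rcases sq_eq_sq_iff_eq_or_eq_neg.1 h1 with e | e
    · exact e
    · have : k z = 0 := by
        rw [e, hkneg] at hxz
        linear_combination (-1 / 2 : ℂ) * hxz
      rw [e, hkzero z this, neg_zero]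
  obtain ⟨x, hx⟩ : ∃ x : ℂ, x ^ 2 = y := IsAlgClosed.exists_pow_nat_eq y two_pos
  have hxy : ‖x‖ ^ 2 = ‖y‖ := by rw [← norm_pow, hx]
  have hx1 : ‖x‖ < 1 := by nlinarith [norm_nonneg x]
  have hx0 : x ≠ 0 := by
    rintro rfl
    exact hy0 (by rw [← hx]; simp)
  have hne : x ≠ -x := by
    intro e
    apply hx0
    linear_combination (1 / 2 : ℂ) * e
  have hmemx : x ∈ ball (0 : ℂ) 1 := by simpa using hx1
  have hmemx' : -x ∈ ball (0 : ℂ) 1 := by simpa using hx1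
  have hymem : y ∈ ball (0 : ℂ) 1 := by simpa using hy
  -- With both pairs equal to `(x, -x)`, oddness turns the mixed quotients into `k x / x`, while the
  -- diagonal ones are the derivatives at `±x`, of equal modulus.
  have key := norm_dslope_mul_le_of_injOn hkd hki (w₁ := x) (w₂ := -x) (z₁ := x) (z₂ := -x) hne
    hx1 (by rwa [norm_neg]) hx1 (by rwa [norm_neg])
  have hslope : dslope k x (-x) = k x / x := by
    rw [dslope_of_ne _ hne.symm, slope_def_field, hkneg]
    field_simp
  have hp : 0 < 1 - ‖y‖ := by linarith
  rw [logKernel_neg_right, add_self_div_two, Real.exp_log (by rw [hxy]; positivity), dslope_same,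
    dslope_same, dslope_comm_field k (-x) x, hslope, hxy, norm_div] at key
  have hder : ∀ z ∈ ball (0 : ℂ) 1, z ^ 2 = y → ‖deriv k z‖ * ‖k z‖ = ‖z‖ * ‖deriv m y‖ := by
    intro z hz hzy
    have h1 : HasDerivAt (fun z => k z ^ 2) (2 * k z * deriv k z) z := by
      have := (hkd.differentiableAt (isOpen_ball.mem_nhds hz)).hasDerivAt.pow 2
      refine this.congr_deriv ?_
      simp
    have h2 : HasDerivAt (fun z => m (z ^ 2)) (deriv m y * (2 * z)) z := by
      have h3 : HasDerivAt m (deriv m y) (z ^ 2) := by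
        rw [hzy]
        exact (hd.differentiableAt (isOpen_ball.mem_nhds hymem)).hasDerivAt
      refine (h3.comp z (hasDerivAt_pow 2 z)).congr_deriv ?_
      simp
    have h4 := h1.unique (h2.congr_of_eventuallyEq
      (Filter.eventually_of_mem (isOpen_ball.mem_nhds hz) hkm))
    have h5 : deriv k z * k z = z * deriv m y := by linear_combination (1 / 2 : ℂ) * h4
    rw [← norm_mul, h5, norm_mul]
  have e1 := hder x hmemx hx
  have e2 := hder (-x) hmemx' (by rw [neg_sq, hx])
  rw [hkneg, norm_neg, norm_neg] at e2
  have hkpos : 0 < ‖k x‖ := norm_pos_iff.2 fun e => hx0 (hkzero x e)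
  have hxpos : 0 < ‖x‖ := norm_pos_iff.2 hx0
  have hmy : ‖m y‖ = ‖k x‖ ^ 2 := by rw [← norm_pow, hkm x hmemx, hx]
  have e3 : ‖deriv k x‖ = ‖deriv k (-x)‖ := mul_right_cancel₀ hkpos.ne' (e1.trans e2.symm)
  rw [← e3] at key
  have e4 : ‖deriv k x‖ ≤ (1 + ‖y‖) / (1 - ‖y‖) * (‖k x‖ / ‖x‖) := by
    refine abs_le_of_sq_le_sq' ?_ (by positivity) |>.2
    calc ‖deriv k x‖ ^ 2 = ‖deriv k x‖ * ‖deriv k x‖ := sq _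
      _ ≤ _ := key
      _ = _ := by ring
  rw [div_mul_div_comm, le_div_iff₀ (by positivity)] at e4
  have e5 : ‖y‖ * ‖deriv m y‖ = ‖x‖ * (‖deriv k x‖ * ‖k x‖) := by rw [e1, ← hxy]; ring
  rw [e5, hmy]
  nlinarith

theorem norm_add_div_one_add_conj_mul_lt_one {w z : ℂ} (hw : ‖w‖ < 1) (hz : ‖z‖ < 1) :
    ‖(z + w) / (1 + (starRingEnd ℂ) w * z)‖ < 1 := by
  have hne : 1 + (starRingEnd ℂ) w * z ≠ 0 := by
    rw [← sub_neg_eq_add, ← neg_mul]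
    refine one_sub_ne_zero_of_norm_lt_one ?_
    rw [norm_mul, norm_neg, Complex.norm_conj]
    nlinarith [norm_nonneg w, norm_nonneg z]
  rw [norm_div, div_lt_one (norm_pos_iff.2 hne)]
  refine lt_of_pow_lt_pow_left₀ 2 (norm_nonneg _) ?_
  have h1 : 0 < (1 - ‖w‖ ^ 2) * (1 - ‖z‖ ^ 2) :=
    mul_pos (by nlinarith [norm_nonneg w]) (by nlinarith [norm_nonneg z])
  have h2 : ‖1 + (starRingEnd ℂ) w * z‖ ^ 2 - ‖z + w‖ ^ 2 = (1 - ‖w‖ ^ 2) * (1 - ‖z‖ ^ 2) := by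
    simp only [← Complex.normSq_eq_norm_sq, Complex.normSq_apply]
    simp
    ring
  linarith

open Metric Set in
/-- The lower bound in the Koebe growth theorem. -/
theorem norm_le_mul_norm_of_injOn {h : ℂ → ℂ} (hd : DifferentiableOn ℂ h (ball 0 1))
    (hi : InjOn h (ball 0 1)) (h0 : h 0 = 0) (h0' : deriv h 0 = 1) {w : ℂ} (hw : ‖w‖ < 1) :
    ‖w‖ ≤ (1 + ‖w‖) ^ 2 * ‖h w‖ := by
  -- The disk automorphism sends 0 to `w` and `-w` to 0. So `h ∘ φ - h w` vanishes at 0, and at `-w`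
  -- it has value `-h w` and derivative `(1 - ‖w‖²)⁻¹`; the logarithmic derivative bound there gives
  -- the growth estimate.
  set φ : ℂ → ℂ := fun z => (z + w) / (1 + (starRingEnd ℂ) w * z) with hφ
  have hne : ∀ z ∈ ball (0 : ℂ) 1, 1 + (starRingEnd ℂ) w * z ≠ 0 := by
    intro z hz
    have hz' : ‖z‖ < 1 := by simpa using hz
    rw [← sub_neg_eq_add, ← neg_mul]
    refine one_sub_ne_zero_of_norm_lt_one ?_
    rw [norm_mul, norm_neg, Complex.norm_conj]
    nlinarith [norm_nonneg w, norm_nonneg z]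
  have hmaps : MapsTo φ (ball 0 1) (ball 0 1) := by
    intro z hz
    rw [mem_ball_zero_iff] at hz ⊢
    exact norm_add_div_one_add_conj_mul_lt_one hw hz
  have hnorm : w * (starRingEnd ℂ) w = ((‖w‖ ^ 2 : ℝ) : ℂ) := by
    rw [Complex.mul_conj, Complex.normSq_eq_norm_sq]
  have hp : 0 < 1 - ‖w‖ ^ 2 := by nlinarith [norm_nonneg w]
  have hpc : (1 - w * (starRingEnd ℂ) w) ≠ 0 := by
    rw [hnorm]
    exact_mod_cast hp.ne'
  have hφi : InjOn φ (ball 0 1) := by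
    intro x hx y hy hxy
    simp only [hφ, div_eq_div_iff (hne x hx) (hne y hy)] at hxy
    have : (x - y) * (1 - w * (starRingEnd ℂ) w) = 0 := by linear_combination hxy
    exact sub_eq_zero.1 ((mul_eq_zero.1 this).resolve_right hpc)
  have hmem : -w ∈ ball (0 : ℂ) 1 := by simpa using hw
  have hφd : DifferentiableOn ℂ φ (ball 0 1) :=
    DifferentiableOn.div (by fun_prop) (by fun_prop) hne
  have hφw : φ (-w) = 0 := by simp [hφ]
  have hφ' : HasDerivAt φ (1 - w * (starRingEnd ℂ) w)⁻¹ (-w) := by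
    have h1 : HasDerivAt (fun z => 1 + (starRingEnd ℂ) w * z) ((starRingEnd ℂ) w) (-w) := by
      simpa using ((hasDerivAt_id (-w)).const_mul ((starRingEnd ℂ) w)).const_add 1
    refine (((hasDerivAt_id (-w)).add_const w).div h1 (hne _ hmem)).congr_deriv ?_
    have h2 : 1 + (starRingEnd ℂ) w * -w = 1 - w * (starRingEnd ℂ) w := by ring
    rw [h2]
    simp
    field_simp
  have hm' : HasDerivAt (fun z => h (φ z) - h w) ((1 - w * (starRingEnd ℂ) w)⁻¹) (-w) := by
    have h1 : HasDerivAt h 1 (φ (-w)) := by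
      rw [hφw, ← h0']
      exact (hd.differentiableAt (isOpen_ball.mem_nhds (mem_ball_self one_pos))).hasDerivAt
    simpa using (h1.comp (-w) hφ').sub_const (h w)
  have key := norm_mul_norm_deriv_le (m := fun z => h (φ z) - h w)
    ((hd.comp hφd hmaps).sub_const _)
    (fun x hx y hy e => hφi hx hy (hi (hmaps hx) (hmaps hy) (sub_left_injective e)))
    (by simp [hφ]) (y := -w) (by rwa [norm_neg])
  rw [hm'.deriv, hφw, h0, zero_sub, norm_neg, norm_neg, norm_inv, hnorm] at key
  rw [show (1 : ℂ) - ((‖w‖ ^ 2 : ℝ) : ℂ) = ((1 - ‖w‖ ^ 2 : ℝ) : ℂ) by push_cast; ring,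
    Complex.norm_real, Real.norm_eq_abs, abs_of_pos hp,
    show 1 - ‖w‖ ^ 2 = (1 - ‖w‖) * (1 + ‖w‖) by ring] at key
  have hp1 : 0 < 1 - ‖w‖ := by linarith
  have hp2 : 0 < 1 + ‖w‖ := by positivity
  have : (1 - ‖w‖) * (‖w‖ * ((1 - ‖w‖) * (1 + ‖w‖))⁻¹) = ‖w‖ / (1 + ‖w‖) := by field_simp
  rw [this, div_le_iff₀ hp2] at key
  linarith

open Metric Set in
/-- A sharp two-point distortion bound on circles centered at the origin. -/
theorem norm_le_mul_norm_dslope {h : ℂ → ℂ} (hd : DifferentiableOn ℂ h (ball 0 1))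
    (hi : InjOn h (ball 0 1)) (h0 : h 0 = 0) (h0' : deriv h 0 = 1) {w z : ℂ} {r : ℝ} (hr : 0 < r)
    (hr1 : r < 1) (hw : ‖w‖ = r) (hz : ‖z‖ = r) :
    (1 - r) * ‖h w‖ ≤ r * (1 + r) * ‖dslope h w z‖ := by
  have h1 := norm_mul_norm_le_norm_dslope hd hi h0 h0' hr hr1 hw hz
  have h2 := norm_le_mul_norm_of_injOn hd hi h0 h0' (hz ▸ hr1 : ‖z‖ < 1)
  rw [hz] at h2
  have h3 : (1 - r ^ 2) * ‖h w‖ * r ≤ (1 - r ^ 2) * ‖h w‖ * ((1 + r) ^ 2 * ‖h z‖) :=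
    mul_le_mul_of_nonneg_left h2 (mul_nonneg (by nlinarith) (norm_nonneg _))
  have h4 : (r * (1 + r)) * ((1 - r) * ‖h w‖) ≤ (r * (1 + r)) * (r * (1 + r) * ‖dslope h w z‖) := by
    nlinarith [mul_le_mul_of_nonneg_left h1 (by positivity : 0 ≤ (1 + r) ^ 2)]
  exact le_of_mul_le_mul_left h4 (by positivity)

/-! ### The radius polynomial. -/

/-- The polynomial whose root in `(0, 1)` is the radius of injectivity. -/
noncomputable def radiusPoly (n : ℕ) (r : ℝ) : ℝ :=
  ((n : ℝ) - 1) * r ^ (n + 1) + ((n : ℝ) + 1) * r ^ n + r - 1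

theorem strictMonoOn_radiusPoly {n : ℕ} (hn : 1 ≤ n) : StrictMonoOn (radiusPoly n) (Set.Ici 0) := by
  intro x hx y _ hxy
  have hx0 : 0 ≤ x := hx
  have hn' : (0 : ℝ) ≤ n - 1 := by
    rw [sub_nonneg]
    exact_mod_cast hn
  have h1 : x ^ (n + 1) ≤ y ^ (n + 1) := by gcongr
  have h2 : x ^ n ≤ y ^ n := by gcongr
  unfold radiusPoly
  nlinarith [mul_le_mul_of_nonneg_left h1 hn',
    mul_le_mul_of_nonneg_left h2 (by positivity : (0 : ℝ) ≤ n + 1)]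

theorem isRadiusRoot_iff {n : ℕ} {r : ℝ} :
    IsRadiusRoot n r ↔ r ∈ Set.Ioo (0 : ℝ) 1 ∧ radiusPoly n r = 0 := Iff.rfl

theorem exists_isRadiusRoot {n : ℕ} (hn : 1 ≤ n) : ∃ ρ, IsRadiusRoot n ρ := by
  have hn' : (1 : ℝ) ≤ n := by exact_mod_cast hn
  have hc : ContinuousOn (radiusPoly n) (Set.Icc 0 1) := by
    unfold radiusPoly
    fun_prop
  have h0 : radiusPoly n 0 < 0 := by
    have : n ≠ 0 := by omega
    simp [radiusPoly, this]
  have h1 : 0 < radiusPoly n 1 := by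
    simp only [radiusPoly, one_pow]
    linarith
  obtain ⟨ρ, hρ, hρ0⟩ := intermediate_value_Ioo zero_le_one hc ⟨h0, h1⟩
  exact ⟨ρ, hρ, hρ0⟩

theorem IsRadiusRoot.mem_Ioo {n : ℕ} (hn : 1 ≤ n) {ρ a b : ℝ} (hρ : IsRadiusRoot n ρ)
    (ha : 0 ≤ a) (hb : 0 ≤ b) (hpa : radiusPoly n a < 0) (hpb : 0 < radiusPoly n b) :
    a < ρ ∧ ρ < b := by
  have h0 : radiusPoly n ρ = 0 := hρ.2
  have hρ0 : (0 : ℝ) ≤ ρ := hρ.1.1.le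
  constructor
  · exact (strictMonoOn_radiusPoly hn).lt_iff_lt ha hρ0 |>.1 (h0 ▸ hpa)
  · exact (strictMonoOn_radiusPoly hn).lt_iff_lt hρ0 hb |>.1 (h0 ▸ hpb)

/-! ### Injectivity inside the radius. -/

/-- The difference quotient of `z ^ n * h z` with respect to `h`. -/
noncomputable def powerQuotient (n : ℕ) (h : ℂ → ℂ) (w z : ℂ) : ℂ :=
  z ^ n + (∑ i ∈ Finset.range n, z ^ i * w ^ (n - 1 - i)) * (h w / dslope h w z)

-- Write the right side as `z^n (h z - h w) + (z^n - w^n) h w` and factor `z^n - w^n` as a geometric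
-- sum.
open Metric Set in
theorem powerQuotient_mul {n : ℕ} {h : ℂ → ℂ} (hd : DifferentiableOn ℂ h (ball 0 1))
    (hi : InjOn h (ball 0 1)) {w z : ℂ} (hw : ‖w‖ < 1) (hz : ‖z‖ < 1) :
    powerQuotient n h w z * (h z - h w) = z ^ n * h z - w ^ n * h w := by
  have hne := dslope_ne_zero_of_injOn isOpen_ball hd hi (a := w) (z := z) (by simpa using hw)
    (by simpa using hz)
  have h1 := sub_smul_dslope h w z
  have h2 := geom_sum₂_mul z w n
  rw [smul_eq_mul] at h1
  unfold powerQuotient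
  rw [← h1, add_mul, mul_assoc _ (h w / dslope h w z), show h w / dslope h w z *
    ((z - w) * dslope h w z) = (z - w) * h w by field_simp, ← mul_assoc (Finset.sum _ _), h2]
  linear_combination z ^ n * h1

open Metric Set in
theorem powerQuotient_comm {n : ℕ} {h : ℂ → ℂ} (hd : DifferentiableOn ℂ h (ball 0 1))
    (hi : InjOn h (ball 0 1)) {w z : ℂ} (hw : ‖w‖ < 1) (hz : ‖z‖ < 1) :
    powerQuotient n h w z = powerQuotient n h z w := by
  rcases eq_or_ne z w with rfl | hzw
  · rfl
  have hne : h z - h w ≠ 0 :=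
    sub_ne_zero.2 fun e => hzw (hi (by simpa using hz) (by simpa using hw) e)
  have h1 := powerQuotient_mul (n := n) hd hi hw hz
  have h2 := powerQuotient_mul (n := n) hd hi hz hw
  refine mul_right_cancel₀ hne ?_
  linear_combination h1 + h2

open Metric Set in
theorem differentiableOn_powerQuotient (n : ℕ) {h : ℂ → ℂ} (hd : DifferentiableOn ℂ h (ball 0 1))
    (hi : InjOn h (ball 0 1)) {w : ℂ} (hw : ‖w‖ < 1) :
    DifferentiableOn ℂ (powerQuotient n h w) (ball 0 1) := by
  have hw' : w ∈ ball (0 : ℂ) 1 := by simpa using hw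
  have h1 : DifferentiableOn ℂ (dslope h w) (ball 0 1) :=
    (Complex.differentiableOn_dslope (isOpen_ball.mem_nhds hw')).2 hd
  have h2 : DifferentiableOn ℂ (fun z => h w / dslope h w z) (ball 0 1) :=
    (differentiableOn_const _).div h1 fun z hz => dslope_ne_zero_of_injOn isOpen_ball hd hi hw' hz
  unfold powerQuotient
  exact DifferentiableOn.add (by fun_prop) (DifferentiableOn.mul (by fun_prop) h2)

theorem norm_sum_pow_mul_pow_le {n : ℕ} {w z : ℂ} {r : ℝ} (hr : 0 ≤ r) (hw : ‖w‖ ≤ r) (hz : ‖z‖ ≤ r) :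
    ‖∑ i ∈ Finset.range n, z ^ i * w ^ (n - 1 - i)‖ ≤ n * r ^ (n - 1) := by
  refine (norm_sum_le_of_le (f := fun i => z ^ i * w ^ (n - 1 - i)) _ (n := fun _ => r ^ (n - 1))
    fun i hi => ?_).trans (by simp)
  have hin : i ≤ n - 1 := by
    have := Finset.mem_range.1 hi
    omega
  rw [norm_mul, norm_pow, norm_pow]
  calc ‖z‖ ^ i * ‖w‖ ^ (n - 1 - i) ≤ r ^ i * r ^ (n - 1 - i) := by gcongr
    _ = r ^ (n - 1) := by rw [← pow_add, Nat.add_sub_cancel' hin]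

open Metric Set in
theorem norm_powerQuotient_le_of_norm_eq {n : ℕ} (hn : 1 ≤ n) {h : ℂ → ℂ}
    (hd : DifferentiableOn ℂ h (ball 0 1)) (hi : InjOn h (ball 0 1)) (h0 : h 0 = 0)
    (h0' : deriv h 0 = 1) {w z : ℂ} {r : ℝ} (hr : 0 < r) (hr1 : r < 1) (hw : ‖w‖ = r) (hz : ‖z‖ = r) :
    ‖powerQuotient n h w z‖ ≤ r ^ n + n * r ^ n * (1 + r) / (1 - r) := by
  have h1 := norm_le_mul_norm_dslope hd hi h0 h0' hr hr1 hw hz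
  have hne := dslope_ne_zero_of_injOn isOpen_ball hd hi (a := w) (z := z) (by simpa [hw] using hr1)
    (by simpa [hz] using hr1)
  have hp : 0 < 1 - r := by linarith
  have h2 : ‖h w / dslope h w z‖ ≤ r * (1 + r) / (1 - r) := by
    rw [norm_div, div_le_div_iff₀ (norm_pos_iff.2 hne) hp]
    linarith
  unfold powerQuotient
  refine (norm_add_le _ _).trans ?_
  rw [norm_mul, norm_pow, hz]
  gcongr
  calc _ ≤ n * r ^ (n - 1) * (r * (1 + r) / (1 - r)) := by
        gcongr
        exact norm_sum_pow_mul_pow_le hr.le hw.le hz.le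
    _ = n * (r ^ (n - 1) * r) * (1 + r) / (1 - r) := by ring
    _ = _ := by rw [← pow_succ, Nat.sub_add_cancel hn]

-- The distortion bound needs `|w| = |z|`. The maximum principle in one variable, symmetry, and the
-- maximum principle in the other reduce the closed bidisk to that case.
open Metric Set in
theorem norm_powerQuotient_le {n : ℕ} (hn : 1 ≤ n) {h : ℂ → ℂ}
    (hd : DifferentiableOn ℂ h (ball 0 1)) (hi : InjOn h (ball 0 1)) (h0 : h 0 = 0)
    (h0' : deriv h 0 = 1) {w z : ℂ} {r : ℝ} (hr : 0 < r) (hr1 : r < 1) (hw : ‖w‖ ≤ r) (hz : ‖z‖ ≤ r) :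
    ‖powerQuotient n h w z‖ ≤ r ^ n + n * r ^ n * (1 + r) / (1 - r) := by
  have hmax : ∀ {w z : ℂ}, ‖w‖ ≤ r → ‖z‖ ≤ r →
      (∀ u : ℂ, ‖u‖ = r → ‖powerQuotient n h w u‖ ≤ r ^ n + n * r ^ n * (1 + r) / (1 - r)) →
      ‖powerQuotient n h w z‖ ≤ r ^ n + n * r ^ n * (1 + r) / (1 - r) := by
    intro w z hw hz hu
    refine Complex.norm_le_of_forall_mem_frontier_norm_le (U := ball 0 r) isBounded_ball ?_ ?_ ?_
    · refine DifferentiableOn.diffContOnCl ?_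
      rw [closure_ball _ hr.ne']
      exact (differentiableOn_powerQuotient n hd hi (hw.trans_lt hr1)).mono
        (closedBall_subset_ball hr1)
    · intro u hu'
      rw [frontier_ball _ hr.ne', mem_sphere_zero_iff_norm] at hu'
      exact hu u hu'
    · rw [closure_ball _ hr.ne']
      simpa using hz
  refine hmax hw hz fun u hu => ?_
  rw [powerQuotient_comm hd hi (hw.trans_lt hr1) (hu ▸ hr1)]
  refine hmax hu.le hw fun v hv => ?_
  exact norm_powerQuotient_le_of_norm_eq hn hd hi h0 h0' hr hr1 hu hv

open Metric Set in
theorem injOn_of_isPowerHar {n : ℕ} (hn : 1 ≤ n) {ρ : ℝ} (hρ : IsRadiusRoot n ρ) {θ : ℝ}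
    {f h g : ℂ → ℂ} (hf : IsPowerHar n θ f h g) : InjOn f (disk ρ) := by
  intro z hz w hw hzw
  have hρ1 : ρ < 1 := hρ.1.2
  have hz' : ‖z‖ < ρ := mem_ball_zero_iff.1 hz
  have hw' : ‖w‖ < ρ := mem_ball_zero_iff.1 hw
  have hz1 : z ∈ disk 1 := mem_ball_zero_iff.2 (hz'.trans hρ1)
  have hw1 : w ∈ disk 1 := mem_ball_zero_iff.2 (hw'.trans hρ1)
  by_contra hne
  obtain ⟨r, hrmax, hrρ⟩ := exists_between (max_lt hz' hw')
  have hzr : ‖z‖ ≤ r := (le_max_left _ _).trans hrmax.le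
  have hwr : ‖w‖ ≤ r := (le_max_right _ _).trans hrmax.le
  have hr : 0 < r := ((norm_nonneg z).trans (le_max_left _ ‖w‖)).trans_lt hrmax
  have hr1 : r < 1 := hrρ.trans hρ1
  have hd := hf.isHar.analytic_part
  have hi := hf.h_injOn
  have hG := norm_powerQuotient_le hn hd hi hf.isHar.h_zero hf.isHar.deriv_h_zero hr hr1 hwr hzr
  -- Multiplied by `1 - r`, this is `radiusPoly n r < 0`.
  have hlt : r ^ n + n * r ^ n * (1 + r) / (1 - r) < 1 := by
    have h1 : radiusPoly n r < radiusPoly n ρ :=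
      strictMonoOn_radiusPoly hn hr.le hρ.1.1.le hrρ
    rw [(isRadiusRoot_iff.1 hρ).2] at h1
    have hp : 0 < 1 - r := by linarith
    rw [← lt_sub_iff_add_lt', div_lt_iff₀ hp]
    unfold radiusPoly at h1
    rw [pow_succ] at h1
    linarith
  have hmul := powerQuotient_mul (n := n) hd hi (hwr.trans_lt hr1) (hzr.trans_lt hr1)
  have heq : h z - h w = -(starRingEnd ℂ) (g z - g w) := by
    rw [hf.isHar.eq_add_conj z hz1, hf.isHar.eq_add_conj w hw1] at hzw
    rw [map_sub]
    linear_combination hzw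
  have hnorm : ‖h z - h w‖ = ‖z ^ n * h z - w ^ n * h w‖ := by
    rw [heq, norm_neg, Complex.norm_conj, hf.g_eq z hz1, hf.g_eq w hw1, mul_assoc, mul_assoc,
      ← mul_sub, norm_mul, Complex.norm_exp_ofReal_mul_I, one_mul]
  have hpos : 0 < ‖h z - h w‖ := norm_pos_iff.2 (sub_ne_zero.2 fun e => hne (hi hz1 hw1 e))
  rw [← hmul, norm_mul] at hnorm
  nlinarith

/-! ### Sharpness: rotated Koebe functions. -/

/-- The restriction of the extremal mapping to the ray where it is real. -/
noncomputable def extremalRay (n : ℕ) (t : ℝ) : ℝ := t * (1 - t ^ n) / (1 + t) ^ 2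

theorem hasDerivAt_extremalRay (n : ℕ) {t : ℝ} (ht : 0 ≤ t) :
    HasDerivAt (extremalRay n) (-radiusPoly n t / (1 + t) ^ 3) t := by
  have h1 : (1 + t) ≠ 0 := by positivity
  have hnum : HasDerivAt (fun t : ℝ => t * (1 - t ^ n)) (1 - (n + 1) * t ^ n) t := by
    have h2 := (hasDerivAt_id t).sub (hasDerivAt_pow (n + 1) t)
    have h3 : (fun t : ℝ => t * (1 - t ^ n)) = id - fun t => t ^ (n + 1) := by
      funext x
      simp [pow_succ]
      ring
    rw [h3]
    simpa using h2
  have hden : HasDerivAt (fun t : ℝ => (1 + t) ^ 2) (2 * (1 + t)) t := by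
    refine (((hasDerivAt_id t).const_add 1).pow 2).congr_deriv ?_
    simp
  refine (hnum.div hden (pow_ne_zero 2 h1)).congr_deriv ?_
  unfold radiusPoly
  rw [div_eq_div_iff (by positivity) (by positivity)]
  ring

/-- Beyond `ρ` the function strictly decreases but stays positive before 1. Its value at `t` thus
lies between those at 0 and `ρ`, and is taken again in `(0, ρ)`. -/
theorem exists_extremalRay_eq {n : ℕ} (hn : 1 ≤ n) {ρ r : ℝ} (hρ : IsRadiusRoot n ρ) (hr : ρ < r)
    (hr1 : r ≤ 1) : ∃ s t : ℝ, 0 < s ∧ s < t ∧ t < r ∧ extremalRay n s = extremalRay n t := by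
  obtain ⟨⟨hρ0, -⟩, hroot⟩ := isRadiusRoot_iff.1 hρ
  obtain ⟨t, ht, htr⟩ := exists_between hr
  have hcont : ∀ {a b : ℝ}, 0 ≤ a → ContinuousOn (extremalRay n) (Set.Icc a b) := fun ha x hx =>
    (hasDerivAt_extremalRay n (ha.trans hx.1)).continuousAt.continuousWithinAt
  have hanti : StrictAntiOn (extremalRay n) (Set.Icc ρ t) := by
    refine strictAntiOn_of_deriv_neg (convex_Icc _ _) (hcont hρ0.le) fun x hx => ?_
    rw [interior_Icc] at hx
    have hx0 : 0 ≤ x := hρ0.le.trans hx.1.le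
    rw [(hasDerivAt_extremalRay n hx0).deriv, neg_div, neg_lt_zero]
    have : radiusPoly n ρ < radiusPoly n x :=
      strictMonoOn_radiusPoly hn hρ0.le hx0 hx.1
    rw [hroot] at this
    positivity
  have h1 : extremalRay n t < extremalRay n ρ :=
    hanti (Set.left_mem_Icc.2 ht.le) (Set.right_mem_Icc.2 ht.le) ht
  have ht0 : 0 < t := hρ0.trans ht
  have h2 : extremalRay n 0 < extremalRay n t := by
    have : t ^ n < 1 := pow_lt_one₀ ht0.le (htr.trans_le hr1) (by omega)
    have h3 : 0 < 1 - t ^ n := by linarith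
    simp only [extremalRay, zero_mul, zero_div]
    positivity
  obtain ⟨s, hs, hst⟩ := intermediate_value_Ioo hρ0.le (hcont le_rfl) ⟨h2, h1⟩
  exact ⟨s, t, hs.1, hs.2.trans ht, htr, hst⟩

/-- Rotations of the Koebe function. -/
noncomputable def koebe (c z : ℂ) : ℂ := z / (1 - c * z) ^ 2

theorem one_sub_mul_ne_zero_of_mem_disk {c z : ℂ} (hc : ‖c‖ = 1) (hz : z ∈ disk 1) :
    1 - c * z ≠ 0 := by
  refine one_sub_ne_zero_of_norm_lt_one ?_
  rw [norm_mul, hc, one_mul]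
  exact mem_ball_zero_iff.1 hz

theorem differentiableOn_koebe {c : ℂ} (hc : ‖c‖ = 1) : DifferentiableOn ℂ (koebe c) (disk 1) := by
  unfold koebe
  exact DifferentiableOn.div (by fun_prop) (by fun_prop)
    fun z hz => pow_ne_zero 2 (one_sub_mul_ne_zero_of_mem_disk hc hz)

theorem deriv_koebe_zero (c : ℂ) : deriv (koebe c) 0 = 1 := by
  have h1 : HasDerivAt (fun z => (1 - c * z) ^ 2) (2 * (1 - c * 0) * -c) 0 := by
    refine ((((hasDerivAt_id (0 : ℂ)).const_mul c).const_sub 1).pow 2).congr_deriv ?_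
    simp
  have h2 := (hasDerivAt_id (0 : ℂ)).div h1 (by simp)
  have h3 : HasDerivAt (koebe c) 1 0 := h2.congr_deriv (by simp)
  exact h3.deriv

theorem injOn_koebe {c : ℂ} (hc : ‖c‖ = 1) : Set.InjOn (koebe c) (disk 1) := by
  intro x hx y hy hxy
  have h1 := one_sub_mul_ne_zero_of_mem_disk hc hx
  have h2 := one_sub_mul_ne_zero_of_mem_disk hc hy
  simp only [koebe, div_eq_div_iff (pow_ne_zero 2 h1) (pow_ne_zero 2 h2)] at hxy
  have h3 : (x - y) * (1 - (c * x) * (c * y)) = 0 := by linear_combination hxy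
  refine sub_eq_zero.1 ((mul_eq_zero.1 h3).resolve_right (one_sub_ne_zero_of_norm_lt_one ?_))
  have hx' : ‖x‖ < 1 := mem_ball_zero_iff.1 hx
  have hy' : ‖y‖ < 1 := mem_ball_zero_iff.1 hy
  rw [norm_mul, norm_mul, norm_mul, hc, one_mul, one_mul]
  nlinarith [norm_nonneg x, norm_nonneg y]

theorem exists_isPowerHar_not_injOn {n : ℕ} (hn : 1 ≤ n) {ρ : ℝ} (hρ : IsRadiusRoot n ρ) (θ : ℝ) :
    ∃ f h g : ℂ → ℂ, IsPowerHar n θ f h g ∧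
      ∀ r : ℝ, ρ < r → r ≤ 1 → ¬ Set.InjOn f (disk r) := by
  -- This `u` makes `conj (g (t u))` equal to `-u t^(n+1)/(1+t)²`, exactly opposed to `h (t u) = u
  -- t/(1+t)²`; `c = -u⁻¹` points the ray away from the pole of the Koebe function.
  obtain ⟨u, hu⟩ : ∃ u : ℂ, u ^ (n + 2) = -Complex.exp (-(θ * Complex.I)) :=
    IsAlgClosed.exists_pow_nat_eq _ (by omega)
  have hun : ‖u‖ = 1 := by
    have h1 := congrArg norm hu
    rw [norm_pow, norm_neg, ← neg_mul, ← Complex.ofReal_neg, Complex.norm_exp_ofReal_mul_I] at h1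
    exact (pow_eq_one_iff_of_nonneg (norm_nonneg u) (by omega)).1 h1
  have hu0 : u ≠ 0 := norm_pos_iff.1 (by rw [hun]; exact one_pos)
  set c : ℂ := -u⁻¹ with hc
  have hcn : ‖c‖ = 1 := by rw [hc, norm_neg, norm_inv, hun, inv_one]
  have hinv : (starRingEnd ℂ) u = u⁻¹ := by
    rw [Complex.inv_def, Complex.normSq_eq_norm_sq, hun]
    simp
  have hexp : Complex.exp (θ * Complex.I) * u ^ (n + 1) = -u⁻¹ := by
    have h1 : Complex.exp (θ * Complex.I) * u ^ (n + 2) = -1 := by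
      rw [hu, mul_neg, ← Complex.exp_add, add_neg_cancel, Complex.exp_zero]
    rw [eq_neg_iff_add_eq_zero]
    field_simp
    linear_combination h1
  set g : ℂ → ℂ := fun z => Complex.exp (θ * Complex.I) * z ^ n * koebe c z with hg
  set f : ℂ → ℂ := fun z => koebe c z + (starRingEnd ℂ) (g z) with hf
  have hray : ∀ t : ℝ, 0 ≤ t → f (t * u) = u * extremalRay n t := by
    intro t ht
    have h1 : (1 + t : ℂ) ≠ 0 := by
      exact_mod_cast (by positivity : (1 + t : ℝ) ≠ 0)
    have h2 : koebe c (t * u) = t * u / (1 + t) ^ 2 := by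
      unfold koebe
      congr 2
      rw [hc]
      field_simp
      ring
    have h3 : g (t * u) = -(t ^ (n + 1) * u⁻¹ / (1 + t) ^ 2) := by
      simp only [hg, h2]
      rw [mul_pow]
      linear_combination (t ^ (n + 1) / (1 + t : ℂ) ^ 2) * hexp
    simp only [hf, h2, h3]
    rw [← hinv]
    simp only [map_neg, map_div₀, map_mul, map_pow, map_add, map_one, Complex.conj_ofReal,
      Complex.conj_conj, extremalRay]
    push_cast
    field_simp
    ring
  refine ⟨f, koebe c, g, ⟨⟨differentiableOn_koebe hcn, ?_, fun z _ => rfl, by simp [koebe],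
    deriv_koebe_zero c, by simp [hg, koebe]⟩, injOn_koebe hcn, fun z _ => rfl⟩, ?_⟩
  · exact DifferentiableOn.mul (by fun_prop) (differentiableOn_koebe hcn)
  · intro r hr hr1 hinj
    obtain ⟨s, t, hs, hst, htr, he⟩ := exists_extremalRay_eq hn hρ hr hr1
    have hmem : ∀ x : ℝ, 0 < x → x < r → (x : ℂ) * u ∈ disk r := by
      intro x hx hxr
      refine mem_ball_zero_iff.2 ?_
      rwa [norm_mul, hun, mul_one, Complex.norm_real, Real.norm_eq_abs, abs_of_pos hx]
    have h1 := hinj (hmem s hs (hst.trans htr)) (hmem t (hs.trans hst) htr)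
      (by rw [hray s hs.le, hray t (hs.trans hst).le, he])
    have h2 := mul_right_cancel₀ hu0 h1
    exact hst.ne (by exact_mod_cast h2)

/-! ### Conclusion and numerical values. -/

theorem corollary2p6 (n : ℕ) (hn : 1 ≤ n) :
    ∃ ρ : ℝ,
      (IsRadiusRoot n ρ ∧ ∀ s : ℝ, IsRadiusRoot n s → s = ρ) ∧
      (∀ (θ : ℝ) (f h g : ℂ → ℂ), IsPowerHar n θ f h g → Set.InjOn f (disk ρ)) ∧
      (∀ θ : ℝ, ∃ f h g : ℂ → ℂ, IsPowerHar n θ f h g ∧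
        ∀ r : ℝ, ρ < r → r ≤ 1 → ¬ Set.InjOn f (disk r)) ∧
      (n = 1 → |ρ - 0.333| < 0.0005) ∧
      (n = 2 → |ρ - 0.414| < 0.0005) ∧
      (n = 3 → |ρ - 0.4738| < 0.00005) ∧
      (n = 4 → |ρ - 0.5201| < 0.00005) ∧
      (n = 5 → |ρ - 0.5574| < 0.00005) := by
  obtain ⟨ρ, hρ⟩ := exists_isRadiusRoot hn
  -- By monotonicity, a sign change of the polynomial between `x - δ` and `x + δ` locates the root.
  have happrox : ∀ x δ : ℝ, 0 ≤ x - δ → 0 ≤ x + δ → radiusPoly n (x - δ) < 0 →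
      0 < radiusPoly n (x + δ) → |ρ - x| < δ := by
    intro x δ h1 h2 h3 h4
    have := hρ.mem_Ioo hn h1 h2 h3 h4
    rw [abs_lt]
    constructor <;> linarith
  refine ⟨ρ, ⟨hρ, fun s hs => ?_⟩, fun θ f h g hf => injOn_of_isPowerHar hn hρ hf,
    exists_isPowerHar_not_injOn hn hρ, ?_, ?_, ?_, ?_, ?_⟩
  · exact (strictMonoOn_radiusPoly hn).injOn hs.1.1.le hρ.1.1.le
      ((isRadiusRoot_iff.1 hs).2.trans (isRadiusRoot_iff.1 hρ).2.symm)
  all_goals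
    rintro rfl
    apply happrox <;> norm_num [radiusPoly]
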